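/- Let $Y$ be a finite set of colours. A *$Y$-coloured uni-trivalent graph* is a finite graph (loops and multiple edges allowed) with trivalent vertices, each with a cyclic ordering of its incident half-edges, and univalent vertices, each with a colour in $Y$; graphs are considered up to isomorphism. A *strut* is a single edge joining two univalent vertices. Let $\mathcal D(Y)$ be the algebra of formal power series over $\mathbb Q$ with these graphs as indeterminates, in which the product of graphs is disjoint union and the empty graph is $1$. An element is *primitive* if it is a (possibly infinite) linear combination of connected (non-empty) graphs, and the *primitive part* of an element is the sum of its terms that are connected graphs. Let $\mathcal D_s(Y)\subset\mathcal D(Y)$ be the subalgebra of the series whose graphs have no component that is a strut with the same colour at its two vertices. Let $X\subset Y$. For graphs $g,h$ let $\langle g,h\rangle_X$ be the sum of the graphs obtained by all ways of identifying, for every $x\in X$, the $x$-coloured univalent vertices of $g$ with those of $h$ by a bijection (vertices being regarded as distinguishable); an identified vertex disappears, and its two edges become one edge. The sum is $0$ if the numbers of $x$-coloured vertices differ for some $x\in X$. Univalent vertices with colours in $Y-X$ are kept. Extend this bilinearly to series: the coefficient of a graph $k$ in $\langle D_1,D_2\rangle_X\in\mathcal D(Y-X)$ is the sum, over all pairs of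 graphs $(g,h)$, of the product of the coefficients of $g$ in $D_1$, of $h$ in $D_2$ and of $k$ in $\langle g,h\rangle_X$; it is *defined* if for every $k$ only finitely many of these products are nonzero. Let $\langle D_1,D_2\rangle_{X,c}$ be the primitive part of $\langle D_1,D_2\rangle_X$. **Theorem.** Let $B\in\mathcal D(Y)$ and $C\in\mathcal D_s(Y)$ be primitive. Assume that struts occurring alternately in $B$ and in $C$ cannot be glued to a circle without vertices: there are no $k\ge1$ and $x_1,\dots,x_{2k}\in X$ such that, with $x_{2k+1}=x_1$, the strut with colours $x_{2i-1},x_{2i}$ has nonzero coefficient in $B$ and the strut with colours $x_{2i},x_{2i+1}$ has nonzero coefficient in $C$ for $1\le i\le k$. (This holds automatically if no strut in $C$ has both colours in $X$, and also if $X$ has at most one element.) Then $\langle\exp B,\exp C\rangle_X$ is defined, and $$\langle \exp B,\exp C\rangle_X=\exp\,\langle \exp B,\exp C\rangle_{X,c}.$$ -/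

import Mathlib

universe u v w

namespace UniTri

/-- A `Y`-coloured uni-trivalent diagram with set of half-edges `H` (an edge is a pair of opposite
half-edges).  The vertices are the orbits of `rot`, which have one or three elements: an orbit with
three elements is a trivalent vertex with the cyclic order given by `rot`, and a fixed point of
`rot` is a univalent vertex, which carries a colour. Loops and multiple edges are allowed. -/
structure Diagram (Y : Type u) (H : Type v) where
  /-- the next half-edge at the same vertex -/
  rot : H → H
  rot_rot_rot : ∀ a, rot (rot (rot a)) = a
  /-- the other half of the same edge -/
  opp : H → H
  opp_opp : ∀ a, opp (opp a) = a
  opp_ne : ∀ a, opp a ≠ a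
  /-- the colour of a univalent vertex -/
  colour : ∀ a, rot a = a → Y

namespace Diagram

variable {Y : Type u} {H : Type v} {K : Type w}

/-- The diagrams `D` and `E` are isomorphic: there is a bijection of half-edges that preserves
vertices, cyclic orders, edges and colours. -/
def Isom (D : Diagram Y H) (E : Diagram Y K) : Prop :=
  ∃ e : H ≃ K, (∀ a, e (D.rot a) = E.rot (e a)) ∧ (∀ a, e (D.opp a) = E.opp (e a)) ∧
    ∀ a (ha : D.rot a = a) (hb : E.rot (e a) = e a), E.colour (e a) hb = D.colour a ha

theorem Isom.refl (D : Diagram Y H) : D.Isom D :=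
  ⟨Equiv.refl H, fun _ => rfl, fun _ => rfl, fun _ _ _ => rfl⟩

theorem Isom.symm {D : Diagram Y H} {E : Diagram Y K} (h : D.Isom E) : E.Isom D := by
  obtain ⟨e, h1, h2, h3⟩ := h
  refine ⟨e.symm, fun a => ?_, fun a => ?_, fun a ha hb => ?_⟩
  · rw [Equiv.symm_apply_eq, h1, Equiv.apply_symm_apply]
  · rw [Equiv.symm_apply_eq, h2, Equiv.apply_symm_apply]
  · obtain ⟨b, rfl⟩ := e.surjective a
    simp only [Equiv.symm_apply_apply] at hb ⊢
    exact (h3 b hb ha).symm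

theorem Isom.trans {L : Type*} {D : Diagram Y H} {E : Diagram Y K} {F : Diagram Y L}
    (h : D.Isom E) (h' : E.Isom F) : D.Isom F := by
  obtain ⟨e, h1, h2, h3⟩ := h
  obtain ⟨f, k1, k2, k3⟩ := h'
  refine ⟨e.trans f, fun a => by simp [h1, k1], fun a => by simp [h2, k2], fun a ha hb => ?_⟩
  have hc : E.rot (e a) = e a := by rw [← h1, ha]
  exact (k3 (e a) hc hb).trans (h3 a ha hc)

/-- Two half-edges belong to the same connected component. -/
def Linked (D : Diagram Y H) : H → H → Prop :=
  Relation.EqvGen fun a b => b = D.rot a ∨ b = D.opp a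

/-- Connected diagrams; the empty diagram does not count as connected. -/
def Connected (D : Diagram Y H) : Prop :=
  Nonempty H ∧ ∀ a b, D.Linked a b

/-- The half-edges at the univalent vertices with colour in `X`. -/
def LegIn (D : Diagram Y H) (X : Set Y) : Type v :=
  {a : H // ∃ ha : D.rot a = a, D.colour a ha ∈ X}

/-- The colour of such a univalent vertex. -/
def legColour (D : Diagram Y H) (X : Set Y) (a : D.LegIn X) : Y :=
  D.colour a.1 a.2.1

end Diagram

open Diagram

/-- Connected finite diagrams with half-edges numbered `0, …, n - 1`. -/
abbrev NumberedConn (Y : Type u) : Type u :=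
  Σ n : ℕ, {D : Diagram Y (Fin n) // D.Connected}

/-- Isomorphism of connected finite diagrams. -/
instance numberedConnSetoid (Y : Type u) : Setoid (NumberedConn Y) where
  r D E := D.2.1.Isom E.2.1
  iseqv := ⟨fun D => Isom.refl D.2.1, fun h => Isom.symm h, fun h h' => Isom.trans h h'⟩

/-- Isomorphism classes of connected finite `Y`-coloured uni-trivalent diagrams. -/
def Conn (Y : Type u) : Type u :=
  Quotient (numberedConnSetoid Y)

/-- The number of half-edges. -/
noncomputable def Conn.size {Y : Type u} (i : Conn Y) : ℕ :=
  (Quotient.out i).1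

/-- A diagram in the isomorphism class `i`. -/
noncomputable def Conn.rep {Y : Type u} (i : Conn Y) : Diagram Y (Fin i.size) :=
  (Quotient.out i).2.1

/-- An isomorphism class of finite diagrams, given by the multiplicities of its components. -/
abbrev Graph (Y : Type u) : Type u :=
  Conn Y →₀ ℕ

/-- A diagram in the class `m`: the disjoint union of `m i` copies of `i`, for all `i`. -/
noncomputable def Graph.diagram {Y : Type u} (m : Graph Y) :
    Diagram Y (Σ i : Conn Y, Fin (m i) × Fin i.size) where
  rot a := ⟨a.1, a.2.1, a.1.rep.rot a.2.2⟩
  rot_rot_rot a := by simp [a.1.rep.rot_rot_rot]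
  opp a := ⟨a.1, a.2.1, a.1.rep.opp a.2.2⟩
  opp_opp a := by simp [a.1.rep.opp_opp]
  opp_ne a h := by
    obtain ⟨i, k, a⟩ := a
    simp only [Sigma.mk.injEq, heq_eq_eq, Prod.mk.injEq, true_and] at h
    exact i.rep.opp_ne a h
  colour a h := a.1.rep.colour a.2.2 (by
    obtain ⟨i, k, a⟩ := a
    simpa using h)

/-- `𝒟(Y)`: formal power series over `ℚ` in `Y`-coloured uni-trivalent graphs, the product of
graphs being disjoint union.  A graph is the monomial of its connected components. -/
abbrev DSeries (Y : Type u) : Type u :=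
  MvPowerSeries (Conn Y) ℚ

/-- The diagram consisting of one edge, with ends coloured by `y` and `z`. -/
def strutDiagram {Y : Type u} (y z : Y) : Diagram Y (Fin 2) where
  rot a := a
  rot_rot_rot _ := rfl
  opp := Fin.rev
  opp_opp := by simp
  opp_ne := by decide
  colour a _ := ![y, z] a

theorem strutDiagram_connected {Y : Type u} (y z : Y) : (strutDiagram y z).Connected := by
  refine ⟨⟨0⟩, fun a b => ?_⟩
  by_cases h : a = b
  · exact h ▸ Relation.EqvGen.refl a
  · refine Relation.EqvGen.rel _ _ (Or.inr ?_)
    change b = Fin.rev a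
    revert h
    revert a b
    decide

/-- The strut with ends coloured by `y` and `z`, as a connected graph. -/
def strut {Y : Type u} (y z : Y) : Conn Y :=
  Quotient.mk (numberedConnSetoid Y) ⟨2, strutDiagram y z, strutDiagram_connected y z⟩

/-- `𝒟ₛ(Y)`: the series whose graphs have no component that is a strut with the same colour at its
two ends. -/
def DSeriesS (Y : Type u) : Subalgebra ℚ (DSeries Y) where
  carrier := {f | ∀ m : Graph Y, MvPowerSeries.coeff m f ≠ 0 → ∀ y, m (strut y y) = 0}
  mul_mem' := by
    classical
    intro f g hf hg m hm y
    rw [MvPowerSeries.coeff_mul] at hm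
    obtain ⟨p, hp, hne⟩ := Finset.exists_ne_zero_of_sum_ne_zero hm
    rw [Finset.HasAntidiagonal.mem_antidiagonal] at hp
    rw [← hp, Finsupp.add_apply, hf _ (left_ne_zero_of_mul hne) y,
      hg _ (right_ne_zero_of_mul hne) y]
  add_mem' := by
    intro f g hf hg m hm y
    by_cases h : MvPowerSeries.coeff m f = 0
    · exact hg m (by intro h'; exact hm (by rw [map_add, h, h', add_zero])) y
    · exact hf m h y
  algebraMap_mem' := by
    classical
    intro r m hm y
    rw [MvPowerSeries.algebraMap_apply, MvPowerSeries.coeff_C] at hm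
    have : m = 0 := by
      by_contra h
      exact hm (by simp [h])
    simp [this]

/-- A series is primitive if it is a (possibly infinite) linear combination of connected graphs. -/
def IsPrimitive {Y : Type u} (f : DSeries Y) : Prop :=
  ∀ m : Graph Y, MvPowerSeries.coeff m f ≠ 0 → ∃ i, m = Finsupp.single i 1

open Classical in
/-- The primitive part of a series: the sum of its terms that are connected graphs. -/
noncomputable def primitivePart {Y : Type u} (f : DSeries Y) : DSeries Y :=
  fun m => if ∃ i, m = Finsupp.single i 1 then MvPowerSeries.coeff m f else 0

/-- The exponential of a series without constant term. -/
noncomputable def expSeries {Y : Type u} (f : DSeries Y) : DSeries Y :=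
  (PowerSeries.exp ℚ).subst f

section Gluing

variable {Y : Type u} (X : Set Y) {H₁ : Type v} {H₂ : Type w}

/-- A way of identifying, for each `x ∈ X`, the `x`-coloured univalent vertices of `g` with those of
`h`. There is none if the numbers of `x`-coloured vertices differ for some `x ∈ X`. -/
def Matching (g : Diagram Y H₁) (h : Diagram Y H₂) : Type (max v w) :=
  {φ : g.LegIn X ≃ h.LegIn X // ∀ a, h.legColour X (φ a) = g.legColour X a}

variable {X}

/-- Two half-edges of `g` and `h` are halves of one edge, or their ends are identified by `φ`. -/
inductive Joined {g : Diagram Y H₁} {h : Diagram Y H₂} (φ : Matching X g h) :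
    H₁ ⊕ H₂ → H₁ ⊕ H₂ → Prop
  | left (a : H₁) : Joined φ (.inl a) (.inl (g.opp a))
  | right (b : H₂) : Joined φ (.inr b) (.inr (h.opp b))
  | glue (a : g.LegIn X) : Joined φ (.inl a.1) (.inr (φ.1 a).1)

/-- `K` is, up to isomorphism, the diagram obtained from `g` and `h` by the identification `φ`.
The identified univalent vertices disappear, and each path of edges of `g` and `h` that are joined
at such vertices becomes one edge of `K`.  All other vertices are kept, with their cyclic orders
and colours. By the last condition the gluing creates no circle without vertices (such a circle
is not a uni-trivalent diagram). -/
def IsGluing {g : Diagram Y H₁} {h : Diagram Y H₂} (φ : Matching X g h)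
    {H₃ : Type*} (K : Diagram (Xᶜ : Set Y) H₃) : Prop :=
  ∃ e : H₃ → H₁ ⊕ H₂, Function.Injective e ∧
    (∀ a, Sum.inl a ∈ Set.range e ↔ ∀ ha : g.rot a = a, g.colour a ha ∉ X) ∧
    (∀ b, Sum.inr b ∈ Set.range e ↔ ∀ hb : h.rot b = b, h.colour b hb ∉ X) ∧
    (∀ c, e (K.rot c) = Sum.map g.rot h.rot (e c)) ∧
    (∀ c (hc : K.rot c = c) a (ha : g.rot a = a), e c = Sum.inl a →
      (K.colour c hc : Y) = g.colour a ha) ∧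
    (∀ c (hc : K.rot c = c) b (hb : h.rot b = b), e c = Sum.inr b →
      (K.colour c hc : Y) = h.colour b hb) ∧
    (∀ c, Relation.EqvGen (Joined φ) (e c) (e (K.opp c))) ∧
    ∀ s, ∃ c, Relation.EqvGen (Joined φ) s (e c)

end Gluing

/-- The coefficient of the graph `k` in `⟨m, n⟩_X`: the number of ways of gluing the univalent
vertices of `m` and `n` with colours in `X` such that the result is `k`. -/
noncomputable def gluingNumber {Y : Type u} (X : Set Y) (m n : Graph Y)
    (k : Graph (Xᶜ : Set Y)) : ℕ :=
  Nat.card {φ : Matching X m.diagram n.diagram // IsGluing φ k.diagram}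

/-- The contribution of the graph `p.1` in `f` and the graph `p.2` in `g` to the coefficient of `k`
in `⟨f, g⟩_X`. -/
noncomputable def gluingTerm {Y : Type u} (X : Set Y) (f g : DSeries Y)
    (k : Graph (Xᶜ : Set Y)) (p : Graph Y × Graph Y) : ℚ :=
  MvPowerSeries.coeff p.1 f * MvPowerSeries.coeff p.2 g * gluingNumber X p.1 p.2 k

/-- `⟨f, g⟩_X` is defined: each of its coefficients is a sum of finitely many nonzero terms. -/
def GluingDefined {Y : Type u} (X : Set Y) (f g : DSeries Y) : Prop :=
  ∀ k, (Function.support (gluingTerm X f g k)).Finite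

/-- The bilinear operator `⟨f, g⟩_X`, with values in `𝒟(Y - X)`. -/
noncomputable def gluing {Y : Type u} (X : Set Y) (f g : DSeries Y) : DSeries (Xᶜ : Set Y) :=
  fun k => ∑ᶠ p, gluingTerm X f g k p

/-- `x, z ∈ X` are the ends of a chain that consists of a strut of `B` and a strut of `C`, glued at
a vertex with colour in `X`. -/
def StrutChain {Y : Type u} (X : Set Y) (B C : DSeries Y) (x z : Y) : Prop :=
  x ∈ X ∧ z ∈ X ∧ ∃ y ∈ X, MvPowerSeries.coeff (Finsupp.single (strut x y) 1) B ≠ 0 ∧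
    MvPowerSeries.coeff (Finsupp.single (strut y z) 1) C ≠ 0

/-- Struts that occur alternately in `B` and in `C` cannot be glued along `X` to a circle (which
is not a uni-trivalent graph, and which would arise from chains of unbounded length). This holds,
for instance, if no strut in `C` has both colours in `X`. -/
def NoStrutCircle {Y : Type u} (X : Set Y) (B C : DSeries Y) : Prop :=
  ∀ x, ¬ Relation.TransGen (StrutChain X B C) x x

end UniTri

/-! For a primitive series with coefficient b_i at the connected graph i, the graph m has
coefficient ∏ b_i^(m_i) / m_i! in the exponential (`coeff_expSeries`). Thus the coefficient times m!
= ∏ m_i! is multiplicative in m. Conversely, a series with constant term 1 and this property is the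
exponential of its primitive part (`eq_expSeries_primitivePart`). So for Z = ⟨exp B, exp C⟩ it
suffices that Z_k Z_l = (k+l)!/(k! l!) Z_(k+l).

This comes from a double count, for fixed m and n, of gluings with result k + l together with a
division of the components of m and n into two parts that the gluing does not mix and that yield k
and l. For a given gluing, the divisions correspond to the ways of dividing the components of the
result, of which there are (k+l)!/(k! l!) (`card_isSplitting_right`). For a given division, the
gluing is a pair of independent gluings (`card_isSplitting_left`). The factorials in exp B and exp C
absorb the number of divisions of m and n with given multiplicities (`sum_gluingTerm`).

For definedness (`gluingDefined_expSeries`), an edge of the result is a path of edges of m and n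
whose inner edges are alternately struts of B and of C with colours in X. As strut chains cannot
close up and Y is finite, the length of such a path is bounded. Hence k bounds the number of
half-edges of m and n, which leaves finitely many pairs. -/

namespace UniTri

/-! ### Components of diagrams, and gluing along an involution -/

namespace Diagram

variable {Y : Type u} {H : Type v} {K : Type w}

theorem opp_involutive (D : Diagram Y H) : Function.Involutive D.opp := D.opp_opp

/-- `f` identifies `D` with a union of connected components of `E`. -/
structure IsEmb (D : Diagram Y H) (E : Diagram Y K) (f : H → K) : Prop where
  inj : Function.Injective f
  rot : ∀ a, f (D.rot a) = E.rot (f a)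
  opp : ∀ a, f (D.opp a) = E.opp (f a)
  colour : ∀ a (ha : D.rot a = a) (hb : E.rot (f a) = f a), E.colour (f a) hb = D.colour a ha

/-- `V` is a union of connected components of `E` that form a diagram isomorphic to `D`. -/
def Copy (D : Diagram Y H) (E : Diagram Y K) (V : Set K) : Prop :=
  ∃ f, D.IsEmb E f ∧ Set.range f = V

/-- `V` is a union of vertices and a union of edges. -/
structure IsClosed (D : Diagram Y H) (V : Set H) : Prop where
  rot : ∀ a ∈ V, D.rot a ∈ V
  opp : ∀ a ∈ V, D.opp a ∈ V

theorem IsClosed.rot_mem_iff {D : Diagram Y H} {V : Set H} (hV : D.IsClosed V) (a : H) :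
    D.rot a ∈ V ↔ a ∈ V :=
  ⟨fun h => by simpa only [D.rot_rot_rot] using hV.rot _ (hV.rot _ h), hV.rot a⟩

theorem IsClosed.opp_mem_iff {D : Diagram Y H} {V : Set H} (hV : D.IsClosed V) (a : H) :
    D.opp a ∈ V ↔ a ∈ V :=
  ⟨fun h => by simpa only [D.opp_opp] using hV.opp _ h, hV.opp a⟩

theorem IsClosed.compl {D : Diagram Y H} {V : Set H} (hV : D.IsClosed V) : D.IsClosed Vᶜ :=
  ⟨fun a h h' => h ((hV.rot_mem_iff a).1 h'), fun a h h' => h ((hV.opp_mem_iff a).1 h')⟩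

theorem IsClosed.mem_iff_of_linked {D : Diagram Y H} {V : Set H} (hV : D.IsClosed V) {a b : H}
    (h : D.Linked a b) : a ∈ V ↔ b ∈ V := by
  induction h with
  | rel a b h =>
    rcases h with rfl | rfl
    · exact (hV.rot_mem_iff a).symm
    · exact (hV.opp_mem_iff a).symm
  | refl => rfl
  | symm _ _ _ ih => exact ih.symm
  | trans _ _ _ _ _ ih ih' => exact ih.trans ih'

theorem Connected.eq_univ {D : Diagram Y H} (hD : D.Connected) {V : Set H} (hV : D.IsClosed V)
    (hne : V.Nonempty) : V = Set.univ := by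
  obtain ⟨a, ha⟩ := hne
  exact Set.eq_univ_of_forall fun b => (hV.mem_iff_of_linked (hD.2 a b)).1 ha

theorem IsEmb.rot_eq_iff {D : Diagram Y H} {E : Diagram Y K} {f : H → K} (hf : D.IsEmb E f)
    (a : H) : E.rot (f a) = f a ↔ D.rot a = a := by
  rw [← hf.rot, hf.inj.eq_iff]

theorem IsEmb.isClosed_range {D : Diagram Y H} {E : Diagram Y K} {f : H → K}
    (hf : D.IsEmb E f) : E.IsClosed (Set.range f) :=
  ⟨by rintro _ ⟨a, rfl⟩; exact ⟨_, hf.rot a⟩, by rintro _ ⟨a, rfl⟩; exact ⟨_, hf.opp a⟩⟩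

theorem Copy.isClosed {D : Diagram Y H} {E : Diagram Y K} {V : Set K} (h : D.Copy E V) :
    E.IsClosed V := by
  obtain ⟨f, hf, rfl⟩ := h
  exact hf.isClosed_range

theorem IsEmb.isClosed_preimage {D : Diagram Y H} {E : Diagram Y K} {f : H → K}
    (hf : D.IsEmb E f) {V : Set K} (hV : E.IsClosed V) : D.IsClosed (f ⁻¹' V) :=
  ⟨fun a h => by rw [Set.mem_preimage, hf.rot]; exact hV.rot _ h,
    fun a h => by rw [Set.mem_preimage, hf.opp]; exact hV.opp _ h⟩

/-- A connected diagram with an embedding into a connected diagram is isomorphic to it. -/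
theorem IsEmb.isom {D : Diagram Y H} {E : Diagram Y K} {f : H → K} (hf : D.IsEmb E f)
    (hD : Nonempty H) (hE : E.Connected) : D.Isom E := by
  have hs : Function.Surjective f := Set.range_eq_univ.1
    (hE.eq_univ hf.isClosed_range (Set.range_nonempty f))
  exact ⟨Equiv.ofBijective f ⟨hf.inj, hs⟩, hf.rot, hf.opp, hf.colour⟩

/-- Two half-edges belong to the same path of edges that are joined by `τ`. -/
def Path (D : Diagram Y H) (τ : H → H) : H → H → Prop :=
  Relation.EqvGen fun s t => t = D.opp s ∨ t = τ s

/-- `τ` exchanges some of the univalent vertices of `D` in pairs. -/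
structure IsPairing (D : Diagram Y H) (τ : H → H) : Prop where
  invol : Function.Involutive τ
  rot : ∀ s, τ s ≠ s → D.rot s = s

/-! ### Paths of edges, and their ends -/

section Pairing

variable {D : Diagram Y H} {τ : H → H}

theorem Path.induction (hτ : D.IsPairing τ) {P : H → Prop} (hopp : ∀ s, P s → P (D.opp s))
    (hP : ∀ s, P s → P (τ s)) {s t : H} (h : D.Path τ s t) : P s ↔ P t := by
  induction h with
  | rel s t h =>
    rcases h with rfl | rfl
    · exact ⟨hopp s, fun h => by simpa only [D.opp_opp] using hopp _ h⟩
    · exact ⟨hP s, fun h => by simpa only [hτ.invol s] using hP _ h⟩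
  | refl => rfl
  | symm _ _ _ ih => exact ih.symm
  | trans _ _ _ _ _ ih ih' => exact ih.trans ih'

theorem Path.refl (s : H) : D.Path τ s s := Relation.EqvGen.refl s

theorem Path.symm {s t : H} (h : D.Path τ s t) : D.Path τ t s := Relation.EqvGen.symm _ _ h

theorem Path.trans {s t r : H} (h : D.Path τ s t) (h' : D.Path τ t r) : D.Path τ s r :=
  Relation.EqvGen.trans _ _ _ h h'

theorem Path.opp (s : H) : D.Path τ s (D.opp s) := Relation.EqvGen.rel _ _ (Or.inl rfl)

theorem Path.pair (s : H) : D.Path τ s (τ s) := Relation.EqvGen.rel _ _ (Or.inr rfl)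

/-- The step along a path: to the other end of the edge and through the vertex there. -/
def IsPairing.step (hτ : D.IsPairing τ) : Equiv.Perm H :=
  D.opp_involutive.toPerm.trans hτ.invol.toPerm

theorem IsPairing.step_apply (hτ : D.IsPairing τ) (s : H) : hτ.step s = τ (D.opp s) := rfl

/-- The step is a product of the two involutions `opp` and `τ`, so conjugation by `τ` inverts it. At
an end of a path, `τ` therefore reverses the direction of travel. -/
theorem IsPairing.pair_step_zpow (hτ : D.IsPairing τ) {s : H} (hs : τ s = s) (n : ℤ) :
    τ ((hτ.step ^ n) s) = (hτ.step ^ (-n)) s := by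
  have key : ∀ a, (hτ.step ^ (-1 : ℤ)) (τ a) = τ (hτ.step a) := fun a => by
    rw [zpow_neg_one, Equiv.Perm.inv_eq_iff_eq, hτ.step_apply, hτ.step_apply,
      hτ.invol (D.opp a), D.opp_opp]
  induction n with
  | zero => simpa using hs
  | succ n ih =>
    rw [show ((n : ℤ) + 1) = 1 + n by ring, zpow_add, zpow_one, Equiv.Perm.mul_apply, ← key, ih,
      ← Equiv.Perm.mul_apply, ← zpow_add]
    congr 2
    ring
  | pred n ih =>
    have : (hτ.step ^ (-(n : ℤ))) s = hτ.step ((hτ.step ^ (-(n : ℤ) - 1)) s) := by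
      rw [← Equiv.Perm.mul_apply, ← zpow_one_add]
      congr 2
      ring
    rw [this, ← key, zpow_neg_one, Equiv.Perm.inv_eq_iff_eq] at ih
    rw [ih, ← Equiv.Perm.mul_apply, ← zpow_one_add]
    congr 2
    ring

/-- The orbit of an end under the step is stable under `τ`, which reverses it, and hence under
`opp`, which is `τ` after the step. -/
theorem Path.exists_zpow (hτ : D.IsPairing τ) {s t : H} (hs : τ s = s) (h : D.Path τ s t) :
    ∃ n : ℤ, t = (hτ.step ^ n) s := by
  refine (h.induction hτ (P := fun t => ∃ n : ℤ, t = (hτ.step ^ n) s) ?_ ?_).1 ⟨0, by simp⟩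
  · rintro _ ⟨n, rfl⟩
    refine ⟨-(n + 1), ?_⟩
    rw [← hτ.pair_step_zpow hs, add_comm, zpow_add, zpow_one, Equiv.Perm.mul_apply,
      hτ.step_apply, hτ.invol]
  · rintro _ ⟨n, rfl⟩
    exact ⟨-n, hτ.pair_step_zpow hs n⟩

/-- A path has at most two ends. -/
theorem Path.end_unique (hτ : D.IsPairing τ) {s t r : H} (hs : τ s = s) (ht : τ t = t)
    (hr : τ r = r) (hst : D.Path τ s t) (hsr : D.Path τ s r) (hts : t ≠ s) (hrs : r ≠ s) :
    t = r := by
  have key : ∀ n : ℤ, (hτ.step ^ n) s = s ↔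
      ((Function.minimalPeriod (hτ.step • ·) s : ℕ) : ℤ) ∣ n := fun n =>
    MulAction.zpow_smul_eq_iff_minimalPeriod_dvd (a := hτ.step) (b := s)
  have two : ∀ n : ℤ, τ ((hτ.step ^ n) s) = (hτ.step ^ n) s → (hτ.step ^ (2 * n)) s = s := by
    intro n h
    rw [hτ.pair_step_zpow hs] at h
    rw [two_mul, zpow_add, Equiv.Perm.mul_apply, ← h, ← Equiv.Perm.mul_apply, ← zpow_add]
    simp
  obtain ⟨a, rfl⟩ := hst.exists_zpow hτ hs
  obtain ⟨b, rfl⟩ := hsr.exists_zpow hτ hs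
  have ha := (key _).1 (two a ht)
  have hb := (key _).1 (two b hr)
  rw [Ne, key] at hts hrs
  -- The period d of `s` divides 2a and 2b but neither a nor b. So 2a and 2b are odd multiples of d,
  -- and d divides a - b.
  have hab : (hτ.step ^ (a - b)) s = s := by
    rw [key]
    generalize ((Function.minimalPeriod (hτ.step • ·) s : ℕ) : ℤ) = d at *
    obtain ⟨x, hx⟩ := ha
    obtain ⟨y, hy⟩ := hb
    rcases Int.even_or_odd' x with ⟨x', rfl | rfl⟩
    · exact absurd ⟨x', by linarith⟩ hts
    rcases Int.even_or_odd' y with ⟨y', rfl | rfl⟩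
    · exact absurd ⟨y', by linarith⟩ hrs
    exact ⟨x' - y', by linarith⟩
  calc (hτ.step ^ a) s = (hτ.step ^ b) ((hτ.step ^ (a - b)) s) := by
        rw [← Equiv.Perm.mul_apply, ← zpow_add]; congr 2; ring
    _ = _ := by rw [hab]

end Pairing

variable {X : Set Y}

/-- `e` identifies the half-edges of `L` with those in `U` that are not exchanged by `τ`, and `E` is
obtained from the part `U` of `D` by gluing along `τ`. -/
structure IsReductionMap {L : Type*} (D : Diagram Y H) (τ : H → H) (U : Set H)
    (E : Diagram (Xᶜ : Set Y) L) (e : L → H) : Prop where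
  inj : Function.Injective e
  mem_range : ∀ s, s ∈ Set.range e ↔ s ∈ U ∧ τ s = s
  rot : ∀ c, e (E.rot c) = D.rot (e c)
  colour : ∀ c (hc : E.rot c = c) (hs : D.rot (e c) = e c), (E.colour c hc : Y) = D.colour (e c) hs
  opp : ∀ c, D.Path τ (e c) (e (E.opp c))
  cover : ∀ s ∈ U, ∃ c, D.Path τ s (e c)

/-- `E` is obtained from the part `U` of `D` by gluing along `τ`. -/
def IsReduction {L : Type*} (D : Diagram Y H) (τ : H → H) (U : Set H)
    (E : Diagram (Xᶜ : Set Y) L) : Prop :=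
  ∃ e, IsReductionMap D τ U E e

/-- `U` is a union of components of the diagram obtained from `D` by gluing along `τ`. -/
structure IsPairClosed (D : Diagram Y H) (τ : H → H) (U : Set H) : Prop extends D.IsClosed U where
  pair : ∀ a ∈ U, τ a ∈ U

/-! ### Reductions: gluing a part of a diagram along a pairing -/

section Reduction

variable {D : Diagram Y H} {τ : H → H} {L : Type*} {E : Diagram (Xᶜ : Set Y) L}

theorem IsPairClosed.compl {U : Set H} (hU : D.IsPairClosed τ U) (hτ : D.IsPairing τ) :
    D.IsPairClosed τ Uᶜ :=
  ⟨hU.toIsClosed.compl, fun a h h' => h (by simpa only [hτ.invol a] using hU.pair _ h')⟩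

theorem IsPairClosed.mem_iff {U : Set H} (hU : D.IsPairClosed τ U) (hτ : D.IsPairing τ) {s t : H}
    (h : D.Path τ s t) : s ∈ U ↔ t ∈ U :=
  h.induction hτ hU.opp hU.pair

theorem IsReductionMap.pair_eq {U : Set H} {e : L → H} (he : D.IsReductionMap τ U E e) (c : L) :
    τ (e c) = e c :=
  ((he.mem_range _).1 ⟨c, rfl⟩).2

/-- The surviving half-edges are ends of paths. The path of `e c` already has the ends `e c` and `e
(E.opp c)`, and there is no room for a third one. -/
theorem IsReductionMap.path_iff {U : Set H} {e : L → H} (he : D.IsReductionMap τ U E e)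
    (hτ : D.IsPairing τ) {c d : L} (h : D.Path τ (e c) (e d)) : d = c ∨ d = E.opp c := by
  by_contra! hne
  exact hne.2 (he.inj (h.end_unique hτ (he.pair_eq c) (he.pair_eq d) (he.pair_eq _) (he.opp c)
    (he.inj.ne hne.1) (he.inj.ne (E.opp_ne c))))

/-- Uniqueness of the reduction. -/
theorem IsReductionMap.copy {L' : Type*} {E' : Diagram (Xᶜ : Set Y) L'} {U : Set H} {e : L → H}
    (he : D.IsReductionMap τ Set.univ E e) (hτ : D.IsPairing τ) (h : D.IsReduction τ U E') :
    E'.Copy E (e ⁻¹' U) := by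
  obtain ⟨e', he'⟩ := h
  -- Both reductions keep exactly the half-edges fixed by `τ`, so the map `f` between them is
  -- forced.
  have hex : ∀ c, ∃ d, e d = e' c := fun c => (he.mem_range _).2 ⟨trivial, he'.pair_eq c⟩
  choose f hf using hex
  have finj : Function.Injective f := fun a b h => he'.inj (by rw [← hf, ← hf, h])
  refine ⟨f, ⟨finj, fun c => he.inj ?_, fun c => ?_, fun c hc hd => Subtype.ext ?_⟩, ?_⟩
  · rw [hf, he'.rot, he.rot, hf]
  · have h := he'.opp c
    rw [← hf, ← hf] at h
    exact (he.path_iff hτ h).resolve_left (finj.ne (E'.opp_ne c))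
  · have hs : D.rot (e (f c)) = e (f c) := by rw [← he.rot, hd]
    have hs' : D.rot (e' c) = e' c := by rw [← he'.rot, hc]
    rw [he.colour _ hd hs, he'.colour _ hc hs']
    congr 1
    exact hf c
  · ext d
    constructor
    · rintro ⟨c, rfl⟩
      rw [Set.mem_preimage, hf]
      exact ((he'.mem_range _).1 ⟨c, rfl⟩).1
    · intro hd
      obtain ⟨c, hc⟩ := (he'.mem_range (e d)).2 ⟨hd, he.pair_eq d⟩
      exact ⟨c, he.inj (by rw [hf, hc])⟩

theorem IsReductionMap.of_copy {L' : Type*} {E' : Diagram (Xᶜ : Set Y) L'} {U : Set H} {e : L → H}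
    (he : D.IsReductionMap τ Set.univ E e) (hτ : D.IsPairing τ) (hU : D.IsPairClosed τ U)
    (h : E'.Copy E (e ⁻¹' U)) : D.IsReduction τ U E' := by
  obtain ⟨f, hf, hr⟩ := h
  have hmem : ∀ d, e d ∈ U ↔ ∃ c, f c = d := fun d => by
    rw [← Set.mem_preimage, ← hr]; rfl
  refine ⟨e ∘ f, he.inj.comp hf.inj, fun s => ⟨?_, ?_⟩, fun c => ?_, fun c hc hs => ?_, fun c => ?_,
    fun s hs => ?_⟩
  · rintro ⟨c, rfl⟩
    exact ⟨(hmem _).2 ⟨c, rfl⟩, he.pair_eq _⟩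
  · rintro ⟨hs, hs'⟩
    obtain ⟨d, rfl⟩ := (he.mem_range s).2 ⟨trivial, hs'⟩
    obtain ⟨c, rfl⟩ := (hmem d).1 hs
    exact ⟨c, rfl⟩
  · simp only [Function.comp_apply, hf.rot, he.rot]
  · have hd : E.rot (f c) = f c := (hf.rot_eq_iff c).2 hc
    rw [← hf.colour c hc hd]
    exact he.colour _ hd hs
  · simp only [Function.comp_apply, hf.opp]
    exact he.opp _
  · obtain ⟨d, hd⟩ := he.cover s trivial
    obtain ⟨c, rfl⟩ := (hmem d).1 ((hU.mem_iff hτ hd).1 hs)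
    exact ⟨c, hd⟩

/-- Reductions of complementary parts form a reduction of the whole diagram. -/
theorem IsReduction.union {L₁ L₂ : Type*} {E₁ : Diagram (Xᶜ : Set Y) L₁}
    {E₂ : Diagram (Xᶜ : Set Y) L₂} {U : Set H} {V : Set L} (h₁ : D.IsReduction τ U E₁)
    (h₂ : D.IsReduction τ Uᶜ E₂) (k₁ : E₁.Copy E V) (k₂ : E₂.Copy E Vᶜ) :
    D.IsReduction τ Set.univ E := by
  obtain ⟨e₁, he₁⟩ := h₁
  obtain ⟨e₂, he₂⟩ := h₂
  obtain ⟨f₁, hf₁, hr₁⟩ := k₁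
  obtain ⟨f₂, hf₂, hr₂⟩ := k₂
  have hdis : ∀ a b, f₁ a ≠ f₂ b := fun a b h => by
    have h1 : f₁ a ∈ V := hr₁ ▸ ⟨a, rfl⟩
    have h2 : f₂ b ∈ Vᶜ := hr₂ ▸ ⟨b, rfl⟩
    exact h2 (h ▸ h1)
  have hbij : Function.Bijective (Sum.elim f₁ f₂) := by
    refine ⟨hf₁.inj.sumElim hf₂.inj hdis, fun c => ?_⟩
    by_cases hc : c ∈ V
    · rw [← hr₁] at hc
      obtain ⟨a, rfl⟩ := hc
      exact ⟨Sum.inl a, rfl⟩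
    · rw [← Set.mem_compl_iff, ← hr₂] at hc
      obtain ⟨a, rfl⟩ := hc
      exact ⟨Sum.inr a, rfl⟩
  set ε := Equiv.ofBijective _ hbij with hε
  have ε₁ : ∀ a, ε.symm (f₁ a) = Sum.inl a := fun a => by rw [Equiv.symm_apply_eq]; rfl
  have ε₂ : ∀ a, ε.symm (f₂ a) = Sum.inr a := fun a => by rw [Equiv.symm_apply_eq]; rfl
  have hcase : ∀ P : L → Prop, (∀ a, P (f₁ a)) → (∀ a, P (f₂ a)) → ∀ c, P c := by
    intro P p₁ p₂ c
    obtain ⟨a | a, rfl⟩ := hbij.2 c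
    exacts [p₁ a, p₂ a]
  have hU₁ : ∀ a, e₁ a ∈ U := fun a => ((he₁.mem_range _).1 ⟨a, rfl⟩).1
  have hU₂ : ∀ a, e₂ a ∉ U := fun a => ((he₂.mem_range _).1 ⟨a, rfl⟩).1
  refine ⟨Sum.elim e₁ e₂ ∘ ε.symm, Function.Injective.comp ?_ ε.symm.injective, fun s => ⟨?_, ?_⟩,
    hcase _ ?_ ?_, hcase _ ?_ ?_, hcase _ ?_ ?_, fun s _ => ?_⟩
  · exact he₁.inj.sumElim he₂.inj fun a b h => hU₂ b (h ▸ hU₁ a)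
  · rintro ⟨c, rfl⟩
    refine ⟨trivial, ?_⟩
    revert c
    refine hcase _ (fun a => ?_) (fun a => ?_)
    · simp only [Function.comp_apply, ε₁, Sum.elim_inl, he₁.pair_eq]
    · simp only [Function.comp_apply, ε₂, Sum.elim_inr, he₂.pair_eq]
  · rintro ⟨-, hs⟩
    by_cases hsU : s ∈ U
    · obtain ⟨a, rfl⟩ := (he₁.mem_range s).2 ⟨hsU, hs⟩
      exact ⟨f₁ a, by simp only [Function.comp_apply, ε₁, Sum.elim_inl]⟩
    · obtain ⟨a, rfl⟩ := (he₂.mem_range s).2 ⟨hsU, hs⟩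
      exact ⟨f₂ a, by simp only [Function.comp_apply, ε₂, Sum.elim_inr]⟩
  · intro a
    simp only [Function.comp_apply, ← hf₁.rot, ε₁, Sum.elim_inl, he₁.rot]
  · intro a
    simp only [Function.comp_apply, ← hf₂.rot, ε₂, Sum.elim_inr, he₂.rot]
  · intro a hc hs
    have ha := (hf₁.rot_eq_iff a).1 hc
    have hs' : D.rot (e₁ a) = e₁ a := by rw [← he₁.rot, ha]
    rw [hf₁.colour a ha hc, he₁.colour a ha hs']
    congr 1
    simp only [Function.comp_apply, ε₁, Sum.elim_inl]
  · intro a hc hs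
    have ha := (hf₂.rot_eq_iff a).1 hc
    have hs' : D.rot (e₂ a) = e₂ a := by rw [← he₂.rot, ha]
    rw [hf₂.colour a ha hc, he₂.colour a ha hs']
    congr 1
    simp only [Function.comp_apply, ε₂, Sum.elim_inr]
  · intro a
    simp only [Function.comp_apply, ← hf₁.opp, ε₁, Sum.elim_inl, he₁.opp]
  · intro a
    simp only [Function.comp_apply, ← hf₂.opp, ε₂, Sum.elim_inr, he₂.opp]
  · by_cases hsU : s ∈ U
    · obtain ⟨a, ha⟩ := he₁.cover s hsU
      exact ⟨f₁ a, by simpa only [Function.comp_apply, ε₁, Sum.elim_inl] using ha⟩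
    · obtain ⟨a, ha⟩ := he₂.cover s hsU
      exact ⟨f₂ a, by simpa only [Function.comp_apply, ε₂, Sum.elim_inr] using ha⟩

/-- The closed subsets of a reduction of `D` correspond to the closed subsets of `D`. -/
theorem IsReductionMap.exists_preimage_eq {e : L → H} (he : D.IsReductionMap τ Set.univ E e)
    (hτ : D.IsPairing τ) {V : Set L} (hV : E.IsClosed V) :
    ∃ U, D.IsPairClosed τ U ∧ e ⁻¹' U = V := by
  have hmem : ∀ c d, c ∈ V → D.Path τ (e d) (e c) → d ∈ V := fun c d hc h => by
    rcases he.path_iff hτ h.symm with rfl | rfl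
    exacts [hc, hV.opp c hc]
  -- The part of `D` over `V` consists of all paths that end in `V`. At a vertex, either the
  -- half-edge survives in the reduction, or it is exchanged by `τ` and `rot` fixes it.
  refine ⟨{s | ∃ c ∈ V, D.Path τ s (e c)}, ⟨⟨?_, ?_⟩, ?_⟩, ?_⟩
  · rintro s ⟨c, hc, h⟩
    by_cases hs : τ s = s
    · obtain ⟨d, rfl⟩ := (he.mem_range s).2 ⟨trivial, hs⟩
      exact ⟨E.rot d, hV.rot d (hmem c d hc h), he.rot d ▸ Path.refl _⟩
    · rw [hτ.rot s hs]
      exact ⟨c, hc, h⟩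
  · rintro s ⟨c, hc, h⟩
    exact ⟨c, hc, (Path.opp s).symm.trans h⟩
  · rintro s ⟨c, hc, h⟩
    exact ⟨c, hc, (Path.pair s).symm.trans h⟩
  · ext d
    exact ⟨fun ⟨c, hc, h⟩ => hmem c d hc h, fun hd => ⟨d, hd, Path.refl _⟩⟩

/-- A set closed under the pairing is a union of paths, and each path has an end that survives in
the reduction, because there are no circles without vertices. -/
theorem IsReductionMap.preimage_injOn {e : L → H} (he : D.IsReductionMap τ Set.univ E e)
    (hτ : D.IsPairing τ) {U U' : Set H} (hU : D.IsPairClosed τ U) (hU' : D.IsPairClosed τ U')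
    (h : e ⁻¹' U = e ⁻¹' U') : U = U' := by
  ext s
  obtain ⟨c, hc⟩ := he.cover s trivial
  rw [hU.mem_iff hτ hc, hU'.mem_iff hτ hc, ← Set.mem_preimage, h, Set.mem_preimage]

/-- The ways of splitting `D` into parts with reductions `E₁` and `E₂` correspond to the ways of
splitting the reduction of `D` into copies of `E₁` and `E₂`. -/
theorem IsReductionMap.ncard_splittings {L₁ L₂ : Type*} {E₁ : Diagram (Xᶜ : Set Y) L₁}
    {E₂ : Diagram (Xᶜ : Set Y) L₂} {e : L → H} (he : D.IsReductionMap τ Set.univ E e)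
    (hτ : D.IsPairing τ) :
    {U | D.IsPairClosed τ U ∧ D.IsReduction τ U E₁ ∧ D.IsReduction τ Uᶜ E₂}.ncard =
      {V | E₁.Copy E V ∧ E₂.Copy E Vᶜ}.ncard := by
  refine Set.ncard_congr (fun U _ => e ⁻¹' U) ?_ ?_ ?_
  · rintro U ⟨-, h₁, h₂⟩
    exact ⟨he.copy hτ h₁, he.copy hτ h₂⟩
  · rintro U U' ⟨hU, -⟩ ⟨hU', -⟩ h
    exact he.preimage_injOn hτ hU hU' h
  · rintro V ⟨h₁, h₂⟩
    obtain ⟨U, hU, rfl⟩ := he.exists_preimage_eq hτ h₁.isClosed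
    exact ⟨U, ⟨hU, he.of_copy hτ hU h₁, he.of_copy hτ (hU.compl hτ) h₂⟩, rfl⟩

/-- The reduction only depends on the part that is reduced. -/
theorem IsEmb.isReduction_iff {H' : Type*} {D' : Diagram Y H'} {τ' : H' → H'} {f : H' → H}
    (hf : D'.IsEmb D f) (hτ : D.IsPairing τ) (hτ' : D'.IsPairing τ')
    (hfτ : ∀ s, f (τ' s) = τ (f s)) :
    D'.IsReduction τ' Set.univ E ↔ D.IsReduction τ (Set.range f) E := by
  have hpath : ∀ s t, D'.Path τ' s t → D.Path τ (f s) (f t) := fun s t h =>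
    (h.induction hτ' (P := fun t => D.Path τ (f s) (f t))
      (fun t ht => ht.trans (hf.opp t ▸ Path.opp _))
      (fun t ht => ht.trans (hfτ t ▸ Path.pair _))).1 (Path.refl _)
  -- The range of `f` is stable under `opp` and `τ`, so a path that starts in it can be lifted.
  have hpath' : ∀ s t, D.Path τ (f s) t → ∃ t', f t' = t ∧ D'.Path τ' s t' := fun s t h =>
    (h.induction hτ (P := fun t => ∃ t', f t' = t ∧ D'.Path τ' s t')
      (by rintro _ ⟨t, rfl, ht⟩; exact ⟨_, hf.opp t, ht.trans (Path.opp _)⟩)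
      (by rintro _ ⟨t, rfl, ht⟩; exact ⟨_, hfτ t, ht.trans (Path.pair _)⟩)).1
      ⟨s, rfl, Path.refl _⟩
  constructor
  · rintro ⟨e, he⟩
    refine ⟨f ∘ e, hf.inj.comp he.inj, fun s => ⟨?_, ?_⟩, fun c => ?_, fun c hc hs => ?_,
      fun c => hpath _ _ (he.opp c), ?_⟩
    · rintro ⟨c, rfl⟩
      exact ⟨⟨_, rfl⟩, by rw [Function.comp_apply, ← hfτ, he.pair_eq]⟩
    · rintro ⟨⟨s, rfl⟩, hs⟩
      rw [← hfτ] at hs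
      obtain ⟨c, rfl⟩ := (he.mem_range s).2 ⟨trivial, hf.inj hs⟩
      exact ⟨c, rfl⟩
    · simp only [Function.comp_apply, he.rot, hf.rot]
    · have hs' := (hf.rot_eq_iff (e c)).1 hs
      rw [he.colour c hc hs']
      exact (hf.colour _ hs' hs).symm
    · rintro _ ⟨s, rfl⟩
      obtain ⟨c, hc⟩ := he.cover s trivial
      exact ⟨c, hpath _ _ hc⟩
  · rintro ⟨e, he⟩
    have hex : ∀ c, ∃ s, f s = e c := fun c => ((he.mem_range _).1 ⟨c, rfl⟩).1
    choose e' he' using hex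
    refine ⟨e', fun a b h => he.inj (by rw [← he', ← he', h]), fun s => ⟨?_, ?_⟩,
      fun c => hf.inj ?_, fun c hc hs => ?_, fun c => ?_, fun s _ => ?_⟩
    · rintro ⟨c, rfl⟩
      exact ⟨trivial, hf.inj (by rw [hfτ, he', he.pair_eq])⟩
    · rintro ⟨-, hs⟩
      obtain ⟨c, hc⟩ := (he.mem_range (f s)).2 ⟨⟨s, rfl⟩, by rw [← hfτ, hs]⟩
      exact ⟨c, hf.inj (by rw [he', hc])⟩
    · rw [he', he.rot, hf.rot, he']
    · have hs' := (hf.rot_eq_iff (e' c)).2 hs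
      have hs'' : D.rot (e c) = e c := by rw [← he.rot, hc]
      rw [← hf.colour _ hs hs', he.colour c hc hs'']
      congr 1
      exact (he' c).symm
    · have h := he.opp c
      rw [← he' c] at h
      obtain ⟨t, ht, h⟩ := hpath' _ _ h
      rw [← he'] at ht
      exact hf.inj ht ▸ h
    · obtain ⟨c, hc⟩ := he.cover (f s) ⟨s, rfl⟩
      obtain ⟨t, ht, h⟩ := hpath' _ _ hc
      rw [← he'] at ht
      exact ⟨c, hf.inj ht ▸ h⟩

end Reduction

end Diagram

end UniTri

/-! ### Multiplicities of sets of components -/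

namespace UniTri

open Diagram

section Multiplicity

variable {ι : Type*} {m : ι →₀ ℕ}

instance finite_sigma_fin (m : ι →₀ ℕ) : Finite (Σ i, Fin (m i)) := by
  have : Function.Injective fun x : Σ i, Fin (m i) =>
      (⟨⟨x.1, Finsupp.mem_support_iff.2 fun h => (h ▸ x.2).elim0⟩, x.2⟩ :
        Σ i : m.support, Fin (m i)) := by
    rintro ⟨i, a⟩ ⟨j, b⟩ h
    simp only [Sigma.mk.injEq, Subtype.mk.injEq] at h
    obtain ⟨rfl, h⟩ := h
    simpa using h
  exact Finite.of_injective _ this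

theorem ncard_fiber (m : ι →₀ ℕ) (i : ι) : {x : Σ i, Fin (m i) | x.1 = i}.ncard = m i := by
  have : {x : Σ i, Fin (m i) | x.1 = i} = Sigma.mk i '' Set.univ := by
    ext ⟨j, a⟩
    constructor
    · rintro rfl
      exact ⟨a, trivial, rfl⟩
    · rintro ⟨b, -, h⟩
      exact (congrArg Sigma.fst h).symm
  rw [this, Set.ncard_image_of_injective _ sigma_mk_injective, Set.ncard_univ,
    Nat.card_eq_fintype_card, Fintype.card_fin]

/-- The multiplicities of the elements of a set of components. -/
noncomputable def mult (S : Set (Σ i, Fin (m i))) : ι →₀ ℕ :=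
  Finsupp.onFinset m.support (fun i => (S ∩ {x | x.1 = i}).ncard) fun i hi => by
    rw [Finsupp.mem_support_iff, ← ncard_fiber m i]
    exact fun h => hi (Nat.le_zero.1 (h ▸ Set.ncard_le_ncard Set.inter_subset_right))

theorem mult_apply (S : Set (Σ i, Fin (m i))) (i : ι) :
    mult S i = (S ∩ {x | x.1 = i}).ncard := rfl

theorem mult_eq_ncard_preimage (S : Set (Σ i, Fin (m i))) (i : ι) :
    mult S i = (Sigma.mk i ⁻¹' S).ncard := by
  have h : S ∩ {x | x.1 = i} = Sigma.mk i '' (Sigma.mk i ⁻¹' S) := by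
    ext ⟨j, a⟩
    constructor
    · rintro ⟨hS, rfl⟩
      exact ⟨a, hS, rfl⟩
    · rintro ⟨b, hb, hba⟩
      cases hba
      exact ⟨hb, rfl⟩
  rw [mult_apply, h, Set.ncard_image_of_injective _ sigma_mk_injective]

theorem mult_add_mult_compl (S : Set (Σ i, Fin (m i))) : mult S + mult Sᶜ = m := by
  ext i
  rw [Finsupp.add_apply, mult_apply, mult_apply, ← Set.ncard_union_eq,
    ← Set.union_inter_distrib_right, Set.union_compl_self, Set.univ_inter, ncard_fiber]
  exact Set.disjoint_left.2 fun x hx hx' => hx'.1 hx.1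

/-- The product of the factorials of the multiplicities. -/
noncomputable def multFact (m : ι →₀ ℕ) : ℚ :=
  m.prod fun _ n => (n.factorial : ℚ)

theorem multFact_ne_zero (m : ι →₀ ℕ) : multFact m ≠ 0 :=
  Finset.prod_ne_zero_iff.2 fun _ _ => Nat.cast_ne_zero.2 (Nat.factorial_ne_zero _)

theorem multFact_eq_prod {m n : ι →₀ ℕ} (h : n ≤ m) :
    multFact n = ∏ i ∈ m.support, ((n i).factorial : ℚ) :=
  Finsupp.prod_of_support_subset _ (Finsupp.support_mono h) _ fun _ _ => by simp

/-- For each type `i` independently, `n i` of the `m i` copies are chosen. -/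
theorem ncard_mult_eq_prod (m n : ι →₀ ℕ) (h : n ≤ m) :
    {S : Set (Σ i, Fin (m i)) | mult S = n}.ncard = ∏ i ∈ m.support, (m i).choose (n i) := by
  classical
  have e : {S : Set (Σ i, Fin (m i)) // mult S = n} ≃
      ∀ i : m.support, {s : Finset (Fin (m i)) // s.card = n i} :=
    { toFun := fun S i => ⟨(Set.toFinite (Sigma.mk i.1 ⁻¹' S.1)).toFinset, by
        rw [← Set.ncard_eq_toFinset_card, ← mult_eq_ncard_preimage, S.2]⟩
      invFun := fun t => ⟨{x | ∀ hx, x.2 ∈ (t ⟨x.1, hx⟩).1}, by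
        ext i
        rw [mult_eq_ncard_preimage]
        by_cases hi : i ∈ m.support
        · rw [← (t ⟨i, hi⟩).2, ← Set.ncard_coe_finset]
          congr 1
          ext a
          exact ⟨fun h => h hi, fun h _ => h⟩
        · have hm : m i = 0 := Finsupp.notMem_support_iff.1 hi
          have hn : n i = 0 := Nat.le_zero.1 (hm ▸ h i)
          have : IsEmpty (Fin (m i)) := by rw [hm]; infer_instance
          rw [hn, Set.eq_empty_of_isEmpty (Sigma.mk i ⁻¹' _), Set.ncard_empty]⟩
      left_inv := fun S => by
        ext ⟨i, a⟩
        simp only [Set.Finite.mem_toFinset, Set.mem_preimage, Set.mem_ofPred_eq]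
        exact ⟨fun h => h (Finsupp.mem_support_iff.2 fun h => (h ▸ a).elim0), fun h _ => h⟩
      right_inv := fun t => by
        ext i a
        simp only [Set.Finite.mem_toFinset, Set.mem_preimage, Set.mem_ofPred_eq]
        exact ⟨fun h => h i.2, fun h _ => h⟩ }
  rw [← Nat.card_coe_set_eq, Set.coe_ofPred, Nat.card_congr e, Nat.card_pi,
    ← Finset.prod_coe_sort m.support fun i => (m i).choose (n i)]
  refine Finset.prod_congr rfl fun i _ => ?_
  rw [Nat.card_eq_fintype_card, Fintype.card_finset_len, Fintype.card_fin]

theorem ncard_mult_eq (m n k : ι →₀ ℕ) (h : n + k = m) :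
    ({S : Set (Σ i, Fin (m i)) | mult S = n}.ncard : ℚ) * (multFact n * multFact k) =
      multFact m := by
  have hn : n ≤ m := h ▸ le_self_add
  have hk : k ≤ m := h ▸ le_add_self
  rw [ncard_mult_eq_prod m n hn, multFact_eq_prod hn, multFact_eq_prod hk,
    multFact_eq_prod le_rfl, Nat.cast_prod, ← Finset.prod_mul_distrib, ← Finset.prod_mul_distrib]
  refine Finset.prod_congr rfl fun i _ => ?_
  have h1 := Nat.choose_mul_factorial_mul_factorial (hn i)
  have h2 : m i - n i = k i := by rw [← h, Finsupp.add_apply, Nat.add_sub_cancel_left]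
  rw [h2] at h1
  rw [← h1]
  push_cast
  ring

end Multiplicity

variable {Y : Type u}

theorem Conn.rep_connected (i : Conn Y) : i.rep.Connected :=
  (Quotient.out i).2.2

theorem Conn.eq_of_isom {i j : Conn Y} (h : i.rep.Isom j.rep) : i = j := by
  rw [← Quotient.out_eq i, ← Quotient.out_eq j]
  exact Quotient.sound h

theorem Conn.rep_isom_of_mk {n : ℕ} {D : Diagram Y (Fin n)} (hD : D.Connected) :
    (Conn.rep (Quotient.mk (numberedConnSetoid Y) ⟨n, D, hD⟩)).Isom D :=
  Quotient.mk_out (s := numberedConnSetoid Y) ⟨n, D, hD⟩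

/-! ### Unions of components of the standard diagram of a graph -/

namespace Graph

variable {m : Graph Y}

/-- The half-edges of `m.diagram`. -/
abbrev Half (m : Graph Y) : Type u :=
  Σ i : Conn Y, Fin (m i) × Fin i.size

/-- The component of a half-edge. -/
def comp (a : m.Half) : Σ i, Fin (m i) :=
  ⟨a.1, a.2.1⟩

/-- The half-edges of a set of components. -/
def block (S : Set (Σ i, Fin (m i))) : Set m.Half :=
  comp ⁻¹' S

theorem mem_block {S : Set (Σ i, Fin (m i))} {a : m.Half} : a ∈ block S ↔ comp a ∈ S := Iff.rfl

theorem block_compl (S : Set (Σ i, Fin (m i))) : block Sᶜ = (block S)ᶜ := rfl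

theorem comp_surjective : Function.Surjective (comp : m.Half → _) := fun x =>
  ⟨⟨x.1, x.2, x.1.rep_connected.1.some⟩, rfl⟩

theorem block_injective : Function.Injective (block : _ → Set m.Half) :=
  comp_surjective.preimage_injective

instance finite_half (m : Graph Y) : Finite m.Half := by
  have : Function.Injective fun a : m.Half =>
      (⟨comp a, a.2.2⟩ : Σ x : (Σ i, Fin (m i)), Fin x.1.size) := by
    rintro ⟨i, a, b⟩ ⟨j, c, d⟩ h
    simp only [comp, Sigma.mk.injEq] at h
    obtain ⟨⟨rfl, h⟩, h'⟩ := h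
    cases h
    cases h'
    rfl
  exact Finite.of_injective _ this

theorem isClosed_block (S : Set (Σ i, Fin (m i))) : m.diagram.IsClosed (block S) :=
  ⟨fun _ h => h, fun _ h => h⟩

/-- The inclusion of a component. -/
def incl (m : Graph Y) (x : Σ i, Fin (m i)) (a : Fin x.1.size) : m.Half :=
  ⟨x.1, x.2, a⟩

theorem isEmb_incl (x : Σ i, Fin (m i)) : x.1.rep.IsEmb m.diagram (m.incl x) where
  inj a b h := by
    simp only [incl, Sigma.mk.injEq, heq_eq_eq, Prod.mk.injEq, true_and] at h
    exact h
  rot _ := rfl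
  opp _ := rfl
  colour _ _ _ := rfl

theorem incl_comp (a : m.Half) : m.incl (comp a) a.2.2 = a := rfl

/-- Each component is connected, so a closed set contains all of it or nothing. -/
theorem mem_iff_of_comp_eq {V : Set m.Half} (hV : m.diagram.IsClosed V) {a b : m.Half}
    (h : comp a = comp b) : a ∈ V ↔ b ∈ V := by
  obtain ⟨x, a', rfl⟩ : ∃ x a', m.incl x a' = a := ⟨_, _, incl_comp a⟩
  obtain ⟨y, b', rfl⟩ : ∃ y b', m.incl y b' = b := ⟨_, _, incl_comp b⟩
  obtain rfl : x = y := h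
  exact ((isEmb_incl x).isClosed_preimage hV).mem_iff_of_linked (x.1.rep_connected.2 a' b')

theorem exists_block_eq {V : Set m.Half} (hV : m.diagram.IsClosed V) : ∃ S, block S = V := by
  refine ⟨comp '' V, ?_⟩
  ext a
  refine ⟨fun ⟨b, hb, hab⟩ => (mem_iff_of_comp_eq hV hab).1 hb, fun h => ⟨a, h, rfl⟩⟩

theorem copy_mult (S : Set (Σ i, Fin (m i))) :
    (Graph.diagram (mult S)).Copy m.diagram (block S) := by
  have hcard : ∀ i, Nonempty
      (Fin (mult S i) ≃ {j : Fin (m i) // (⟨i, j⟩ : Σ i, Fin (m i)) ∈ S}) := by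
    intro i
    rw [mult_eq_ncard_preimage, ← Nat.card_coe_set_eq]
    exact ⟨(Finite.equivFin (Sigma.mk i ⁻¹' S)).symm⟩
  let ε := fun i => (hcard i).some
  refine ⟨fun a => ⟨a.1, (ε a.1 a.2.1).1, a.2.2⟩, ⟨?_, fun _ => rfl, fun _ => rfl,
    fun _ _ _ => rfl⟩, ?_⟩
  · rintro ⟨i, a, b⟩ ⟨j, c, d⟩ h
    simp only [Sigma.mk.injEq] at h
    obtain ⟨rfl, h⟩ := h
    simp only [heq_eq_eq, Prod.mk.injEq] at h
    obtain ⟨h, rfl⟩ := h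
    rw [(ε i).injective (Subtype.ext h)]
  · ext ⟨i, a, b⟩
    constructor
    · rintro ⟨⟨j, c, d⟩, h⟩
      cases h
      exact (ε _ _).2
    · intro h
      exact ⟨⟨i, (ε i).symm ⟨a, h⟩, b⟩, by simp⟩

/-- An embedding sends each component into a single component, by connectedness, and onto it.
Isomorphic representatives belong to the same class, so the induced map `c` of components is
injective, preserves types and has image `S`. -/
theorem mult_eq_of_copy {n : Graph Y} {S : Set (Σ i, Fin (m i))}
    (h : n.diagram.Copy m.diagram (block S)) : mult S = n := by
  obtain ⟨f, hf, hr⟩ := h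
  have key : ∀ x : Σ i, Fin (n i), ∃ y : Σ i, Fin (m i), y.1 = x.1 ∧
      (∀ a, comp (f (n.incl x a)) = y) ∧ ∀ b, ∃ a, f (n.incl x a) = m.incl y b := by
    intro x
    obtain ⟨a₀⟩ := x.1.rep_connected.1
    set y := comp (f (n.incl x a₀)) with hy
    have hc : ∀ a, comp (f (n.incl x a)) = y := fun a => by
      have h1 := (hf.isClosed_preimage (isClosed_block {y}))
      have h2 := (mem_iff_of_comp_eq h1 (a := n.incl x a₀) (b := n.incl x a) rfl).1
      exact h2 hy.symm
    have hg : ∀ a, ∃ b, m.incl y b = f (n.incl x a) := fun a => by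
      have h1 := incl_comp (f (n.incl x a))
      have h2 : ∀ (z : Σ i, Fin (m i)) (c : Fin z.1.size), z = y →
          ∃ b, m.incl y b = m.incl z c := by
        rintro z c rfl
        exact ⟨c, rfl⟩
      rw [← h1]
      exact h2 _ _ (hc a)
    choose g hg using hg
    have hinc := isEmb_incl (m := m) y
    have hx := isEmb_incl (m := n) x
    have gemb : x.1.rep.IsEmb y.1.rep g :=
      { inj := fun a b hab => hx.inj (hf.inj (by rw [← hg, ← hg, hab]))
        rot := fun a => hinc.inj (by rw [hg, hx.rot, hf.rot, hinc.rot, hg])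
        opp := fun a => hinc.inj (by rw [hg, hx.opp, hf.opp, hinc.opp, hg])
        colour := fun a ha hb => by
          have h1 := (hx.rot_eq_iff a).2 ha
          have h2 := (hf.rot_eq_iff _).2 h1
          have h3 := (hinc.rot_eq_iff _).2 hb
          rw [← hx.colour a ha h1, ← hf.colour _ h1 h2, ← hinc.colour _ hb h3]
          congr 1
          exact hg a }
    refine ⟨y, (Conn.eq_of_isom (gemb.isom ⟨a₀⟩ y.1.rep_connected)).symm, hc, fun b => ?_⟩
    have := y.1.rep_connected.eq_univ gemb.isClosed_range ⟨_, a₀, rfl⟩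
    obtain ⟨a, rfl⟩ := Set.range_eq_univ.1 this b
    exact ⟨a, (hg a).symm⟩
  choose c hc1 hc2 hc3 using key
  have cinj : Function.Injective c := by
    intro x x' h
    obtain ⟨a⟩ := (c x).1.rep_connected.1
    obtain ⟨b, hb⟩ := hc3 x a
    obtain ⟨b', hb'⟩ := hc3 x' (h ▸ a)
    have : m.incl (c x) a = m.incl (c x') (h ▸ a) := by
      generalize c x' = z at h
      subst h
      rfl
    exact congrArg comp (hf.inj (hb.trans (this.trans hb'.symm)))
  have hS : ∀ y, y ∈ S ↔ ∃ x, c x = y := by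
    intro y
    obtain ⟨b, rfl⟩ := comp_surjective y
    rw [← mem_block, ← hr]
    constructor
    · rintro ⟨a, rfl⟩
      exact ⟨comp a, (hc2 (comp a) a.2.2).symm⟩
    · rintro ⟨x, hx⟩
      rw [hf.isClosed_range |> mem_iff_of_comp_eq <| hx.symm.trans
        (hc2 x x.1.rep_connected.1.some).symm]
      exact ⟨_, rfl⟩
  ext i
  rw [mult_apply, ← ncard_fiber n i, ← Set.ncard_image_of_injective _ cinj]
  congr 1
  ext y
  constructor
  · rintro ⟨hy, rfl⟩
    obtain ⟨x, rfl⟩ := (hS y).1 hy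
    exact ⟨x, (hc1 x).symm, rfl⟩
  · rintro ⟨x, rfl, rfl⟩
    exact ⟨(hS _).2 ⟨x, rfl⟩, hc1 x⟩

theorem copy_iff {n : Graph Y} {S : Set (Σ i, Fin (m i))} :
    n.diagram.Copy m.diagram (block S) ↔ mult S = n :=
  ⟨mult_eq_of_copy, fun h => h ▸ copy_mult S⟩

/-- The number of ways of splitting `m` into `n` and `k`. -/
theorem ncard_copy (m n k : Graph Y) (h : n + k = m) :
    {V | n.diagram.Copy m.diagram V ∧ k.diagram.Copy m.diagram Vᶜ}.ncard =
      {S : Set (Σ i, Fin (m i)) | mult S = n}.ncard := by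
  symm
  refine Set.ncard_congr (fun S _ => block S) ?_ (fun _ _ _ _ h => block_injective h) ?_
  · rintro S (hS : mult S = n)
    refine ⟨copy_iff.2 hS, ?_⟩
    rw [← block_compl, copy_iff]
    have := mult_add_mult_compl S
    rw [hS] at this
    exact add_left_cancel (this.trans h.symm)
  · rintro V ⟨hV, -⟩
    obtain ⟨S, rfl⟩ := exists_block_eq hV.isClosed
    exact ⟨S, copy_iff.1 hV, rfl⟩

end Graph

end UniTri

/-! ### Gluing two diagrams as a reduction of their disjoint union -/

namespace UniTri

open Diagram

namespace Diagram

variable {Y : Type u} {H₁ : Type v} {H₂ : Type w}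

/-- The disjoint union of two diagrams. -/
def sum (g : Diagram Y H₁) (h : Diagram Y H₂) : Diagram Y (H₁ ⊕ H₂) where
  rot := Sum.map g.rot h.rot
  rot_rot_rot := by rintro (a | a) <;> simp [g.rot_rot_rot, h.rot_rot_rot]
  opp := Sum.map g.opp h.opp
  opp_opp := by rintro (a | a) <;> simp [g.opp_opp, h.opp_opp]
  opp_ne := by rintro (a | a) <;> simp [g.opp_ne, h.opp_ne]
  colour
    | .inl a, ha => g.colour a (Sum.inl_injective ha)
    | .inr b, hb => h.colour b (Sum.inr_injective hb)

theorem IsEmb.sumMap {H₃ H₄ : Type*} {g : Diagram Y H₁} {h : Diagram Y H₂} {g' : Diagram Y H₃}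
    {h' : Diagram Y H₄} {α : H₃ → H₁} {β : H₄ → H₂} (hα : g'.IsEmb g α) (hβ : h'.IsEmb h β) :
    (g'.sum h').IsEmb (g.sum h) (Sum.map α β) where
  inj := hα.inj.sumMap hβ.inj
  rot := by rintro (a | a) <;> simp [sum, hα.rot, hβ.rot]
  opp := by rintro (a | a) <;> simp [sum, hα.opp, hβ.opp]
  colour := by
    rintro (a | a) ha hb
    · exact hα.colour a (Sum.inl_injective ha) (Sum.inl_injective hb)
    · exact hβ.colour a (Sum.inr_injective ha) (Sum.inr_injective hb)

/-- The half-edge at a univalent vertex with colour in `X`. -/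
def LegIn.half {D : Diagram Y H₁} {X : Set Y} (a : D.LegIn X) : H₁ := a.1

/-- A half-edge at a univalent vertex with colour in `X`. -/
def toLeg {D : Diagram Y H₁} {X : Set Y} {a : H₁} (ha : ∃ ha : D.rot a = a, D.colour a ha ∈ X) :
    D.LegIn X := ⟨a, ha⟩

theorem half_toLeg {D : Diagram Y H₁} {X : Set Y} {a : H₁}
    (ha : ∃ ha : D.rot a = a, D.colour a ha ∈ X) : (toLeg ha).half = a := rfl

/-- The embedding of legs. -/
def IsEmb.leg {D : Diagram Y H₁} {E : Diagram Y H₂} {f : H₁ → H₂} (hf : D.IsEmb E f) (X : Set Y)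
    (a : D.LegIn X) : E.LegIn X :=
  ⟨f a.1, (hf.rot_eq_iff a.1).2 a.2.1, by rw [hf.colour a.1 a.2.1]; exact a.2.2⟩

theorem IsEmb.half_leg {D : Diagram Y H₁} {E : Diagram Y H₂} {f : H₁ → H₂} (hf : D.IsEmb E f)
    (X : Set Y) (a : D.LegIn X) : (hf.leg X a).half = f a.half := rfl

theorem IsEmb.leg_injective {D : Diagram Y H₁} {E : Diagram Y H₂} {f : H₁ → H₂}
    (hf : D.IsEmb E f) (X : Set Y) : Function.Injective (hf.leg X) := fun _ _ h =>
  Subtype.ext (hf.inj (congrArg Subtype.val h))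

theorem IsEmb.legColour_leg {D : Diagram Y H₁} {E : Diagram Y H₂} {f : H₁ → H₂}
    (hf : D.IsEmb E f) (X : Set Y) (a : D.LegIn X) :
    E.legColour X (hf.leg X a) = D.legColour X a :=
  hf.colour a.1 a.2.1 _

theorem IsEmb.exists_leg_eq {D : Diagram Y H₁} {E : Diagram Y H₂} {f : H₁ → H₂}
    (hf : D.IsEmb E f) (X : Set Y) (b : E.LegIn X) (hb : b.half ∈ Set.range f) :
    ∃ a, hf.leg X a = b := by
  obtain ⟨_, h1, h2⟩ := b
  obtain ⟨a, rfl⟩ := hb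
  have ha := (hf.rot_eq_iff a).1 h1
  exact ⟨⟨a, ha, by rw [← hf.colour a ha h1]; exact h2⟩, rfl⟩

/-- The legs of a diagram are those of two complementary parts. -/
noncomputable def legSplit {H₃ : Type*} {D₁ : Diagram Y H₁} {D₂ : Diagram Y H₂} {D : Diagram Y H₃}
    {f₁ : H₁ → H₃} {f₂ : H₂ → H₃} (hf₁ : D₁.IsEmb D f₁) (hf₂ : D₂.IsEmb D f₂)
    (hr : Set.range f₂ = (Set.range f₁)ᶜ) (X : Set Y) : D₁.LegIn X ⊕ D₂.LegIn X ≃ D.LegIn X :=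
  Equiv.ofBijective (Sum.elim (hf₁.leg X) (hf₂.leg X)) (by
    refine ⟨(hf₁.leg_injective X).sumElim (hf₂.leg_injective X) fun a b h => ?_, fun c => ?_⟩
    · have h1 : f₂ b.1 ∈ (Set.range f₁)ᶜ := hr ▸ ⟨b.1, rfl⟩
      exact h1 ⟨a.1, congrArg Subtype.val h⟩
    · by_cases hc : c.half ∈ Set.range f₁
      · obtain ⟨a, rfl⟩ := hf₁.exists_leg_eq X c hc
        exact ⟨Sum.inl a, rfl⟩
      · rw [← Set.mem_compl_iff, ← hr] at hc
        obtain ⟨a, rfl⟩ := hf₂.exists_leg_eq X c hc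
        exact ⟨Sum.inr a, rfl⟩)

end Diagram

variable {Y : Type u} {X : Set Y} {H₁ : Type v} {H₂ : Type w} {g : Diagram Y H₁} {h : Diagram Y H₂}

/-- The bijection between the univalent vertices that are identified. -/
def Matching.equiv (φ : Matching X g h) : g.LegIn X ≃ h.LegIn X := φ.1

theorem Matching.legColour_equiv (φ : Matching X g h) (a : g.LegIn X) :
    h.legColour X (φ.equiv a) = g.legColour X a := φ.2 a

theorem Matching.ext {φ ψ : Matching X g h} (hφ : ∀ a, φ.equiv a = ψ.equiv a) : φ = ψ :=
  Subtype.ext (Equiv.ext hφ)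

open Classical in
/-- The involution that exchanges the legs that are identified. -/
noncomputable def Matching.glue (φ : Matching X g h) : H₁ ⊕ H₂ → H₁ ⊕ H₂
  | .inl a => if ha : ∃ ha : g.rot a = a, g.colour a ha ∈ X then .inr (φ.equiv (toLeg ha)).half
      else .inl a
  | .inr b => if hb : ∃ hb : h.rot b = b, h.colour b hb ∈ X then .inl (φ.equiv.symm (toLeg hb)).half
      else .inr b

theorem Matching.glue_inl (φ : Matching X g h) (a : g.LegIn X) :
    φ.glue (.inl a.half) = .inr (φ.equiv a).half :=
  dif_pos a.2

theorem Matching.glue_inr (φ : Matching X g h) (b : h.LegIn X) :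
    φ.glue (.inr b.half) = .inl (φ.equiv.symm b).half :=
  dif_pos b.2

theorem Matching.glue_inl_of_not (φ : Matching X g h) {a : H₁}
    (ha : ¬ ∃ ha : g.rot a = a, g.colour a ha ∈ X) : φ.glue (.inl a) = .inl a :=
  dif_neg ha

theorem Matching.glue_inr_of_not (φ : Matching X g h) {b : H₂}
    (hb : ¬ ∃ hb : h.rot b = b, h.colour b hb ∈ X) : φ.glue (.inr b) = .inr b :=
  dif_neg hb

theorem Matching.glue_inl_eq_iff (φ : Matching X g h) {a : H₁} :
    φ.glue (.inl a) = .inl a ↔ ∀ ha : g.rot a = a, g.colour a ha ∉ X := by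
  rw [← not_exists]
  refine ⟨fun h1 h2 => ?_, φ.glue_inl_of_not⟩
  rw [← half_toLeg h2, φ.glue_inl (toLeg h2)] at h1
  cases h1

theorem Matching.glue_inr_eq_iff (φ : Matching X g h) {b : H₂} :
    φ.glue (.inr b) = .inr b ↔ ∀ hb : h.rot b = b, h.colour b hb ∉ X := by
  rw [← not_exists]
  refine ⟨fun h1 h2 => ?_, φ.glue_inr_of_not⟩
  rw [← half_toLeg h2, φ.glue_inr (toLeg h2)] at h1
  cases h1

theorem Matching.isPairing_glue (φ : Matching X g h) : (g.sum h).IsPairing φ.glue where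
  invol := by
    rintro (a | b)
    · by_cases ha : ∃ ha : g.rot a = a, g.colour a ha ∈ X
      · rw [← half_toLeg ha, φ.glue_inl (toLeg ha), φ.glue_inr, Equiv.symm_apply_apply]
      · rw [φ.glue_inl_of_not ha, φ.glue_inl_of_not ha]
    · by_cases hb : ∃ hb : h.rot b = b, h.colour b hb ∈ X
      · rw [← half_toLeg hb, φ.glue_inr (toLeg hb), φ.glue_inl, Equiv.apply_symm_apply]
      · rw [φ.glue_inr_of_not hb, φ.glue_inr_of_not hb]
  rot := by
    rintro (a | b) h1
    · rw [Ne, φ.glue_inl_eq_iff] at h1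
      push Not at h1
      exact congrArg Sum.inl h1.1
    · rw [Ne, φ.glue_inr_eq_iff] at h1
      push Not at h1
      exact congrArg Sum.inr h1.1

theorem path_glue_iff (φ : Matching X g h) (s t : H₁ ⊕ H₂) :
    (g.sum h).Path φ.glue s t ↔ Relation.EqvGen (Joined φ) s t := by
  constructor
  · intro hst
    refine (hst.induction φ.isPairing_glue (P := Relation.EqvGen (Joined φ) s) (fun t ht => ?_)
      (fun t ht => ?_)).1 (Relation.EqvGen.refl s)
    · refine ht.trans _ _ _ (Relation.EqvGen.rel _ _ ?_)
      rcases t with a | b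
      exacts [.left a, .right b]
    · refine ht.trans _ _ _ ?_
      rcases t with a | b
      · by_cases ha : ∃ ha : g.rot a = a, g.colour a ha ∈ X
        · rw [← half_toLeg ha, φ.glue_inl (toLeg ha)]
          exact .rel _ _ (.glue (toLeg ha))
        · rw [φ.glue_inl_of_not ha]
          exact .refl _
      · by_cases hb : ∃ hb : h.rot b = b, h.colour b hb ∈ X
        · rw [← half_toLeg hb, φ.glue_inr (toLeg hb)]
          refine .symm _ _ (.rel _ _ ?_)
          have : Joined φ (.inl (φ.equiv.symm (toLeg hb)).half)
              (.inr (φ.equiv (φ.equiv.symm (toLeg hb))).half) := .glue _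
          rwa [Equiv.apply_symm_apply] at this
        · rw [φ.glue_inr_of_not hb]
          exact .refl _
  · refine Relation.EqvGen.mono ?_ _ _
    rintro _ _ (a | b | a)
    · exact Or.inl rfl
    · exact Or.inl rfl
    · exact Or.inr (φ.glue_inl a).symm

/-- This replaces a gluing of two diagrams by one diagram with an involution, to which the results
on reductions apply. -/
theorem isGluing_iff (φ : Matching X g h) {H₃ : Type*} (K : Diagram (Xᶜ : Set Y) H₃) :
    IsGluing φ K ↔ (g.sum h).IsReduction φ.glue Set.univ K := by
  refine exists_congr fun e => ?_
  constructor
  · rintro ⟨h1, h2, h3, h4, h5, h6, h7, h8⟩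
    refine ⟨h1, ?_, h4, ?_, fun c => (path_glue_iff φ _ _).2 (h7 c), fun s _ => ?_⟩
    · rintro (a | b)
      · rw [h2, φ.glue_inl_eq_iff]
        exact (and_iff_right trivial).symm
      · rw [h3, φ.glue_inr_eq_iff]
        exact (and_iff_right trivial).symm
    · intro c hc hs
      specialize h5 c hc
      specialize h6 c hc
      generalize e c = s at *
      rcases s with a | b
      · exact h5 a (Sum.inl_injective hs) rfl
      · exact h6 b (Sum.inr_injective hs) rfl
    · obtain ⟨c, hc⟩ := h8 s
      exact ⟨c, (path_glue_iff φ _ _).2 hc⟩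
  · rintro ⟨h1, h2, h3, h4, h5, h6⟩
    refine ⟨h1, fun a => ?_, fun b => ?_, h3, ?_, ?_, fun c => (path_glue_iff φ _ _).1 (h5 c),
      fun s => ?_⟩
    · rw [h2, φ.glue_inl_eq_iff]
      exact and_iff_right trivial
    · rw [h2, φ.glue_inr_eq_iff]
      exact and_iff_right trivial
    · intro c hc a ha hs
      specialize h4 c hc
      generalize e c = s at *
      subst hs
      exact h4 (congrArg Sum.inl ha)
    · intro c hc b hb hs
      specialize h4 c hc
      generalize e c = s at *
      subst hs
      exact h4 (congrArg Sum.inr hb)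
    · obtain ⟨c, hc⟩ := h6 s trivial
      exact ⟨c, (path_glue_iff φ _ _).1 hc⟩

/-! ### Restricting gluings to parts, and composing them from parts -/

section Restrict

variable {H₃ H₄ : Type*} {g' : Diagram Y H₃} {h' : Diagram Y H₄} {α : H₃ → H₁} {β : H₄ → H₂}

theorem glue_comm (hα : g'.IsEmb g α) (hβ : h'.IsEmb h β) {φ : Matching X g h}
    {φ' : Matching X g' h'} (hφ : ∀ a, φ.equiv (hα.leg X a) = hβ.leg X (φ'.equiv a)) (s : H₃ ⊕ H₄) :
    Sum.map α β (φ'.glue s) = φ.glue (Sum.map α β s) := by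
  rcases s with a | b
  · by_cases ha : ∃ ha : g'.rot a = a, g'.colour a ha ∈ X
    · rw [← half_toLeg ha, φ'.glue_inl (toLeg ha)]
      have h1 := φ.glue_inl (hα.leg X (toLeg ha))
      rw [hφ] at h1
      exact h1.symm
    · rw [φ'.glue_inl_of_not ha, Sum.map_inl, φ.glue_inl_of_not]
      rintro ⟨h1, h2⟩
      have h3 := (hα.rot_eq_iff a).1 h1
      exact ha ⟨h3, by rwa [← hα.colour a h3 h1]⟩
  · by_cases hb : ∃ hb : h'.rot b = b, h'.colour b hb ∈ X
    · rw [← half_toLeg hb, φ'.glue_inr (toLeg hb)]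
      have h1 := φ.glue_inr (hβ.leg X (toLeg hb))
      have h2 := hφ (φ'.equiv.symm (toLeg hb))
      rw [Equiv.apply_symm_apply, ← Equiv.eq_symm_apply] at h2
      rw [← h2] at h1
      exact h1.symm
    · rw [φ'.glue_inr_of_not hb, Sum.map_inr, φ.glue_inr_of_not]
      rintro ⟨h1, h2⟩
      have h3 := (hβ.rot_eq_iff b).1 h1
      exact hb ⟨h3, by rwa [← hβ.colour b h3 h1]⟩

theorem isReduction_range_iff (hα : g'.IsEmb g α) (hβ : h'.IsEmb h β) {φ : Matching X g h}
    {φ' : Matching X g' h'} (hφ : ∀ a, φ.equiv (hα.leg X a) = hβ.leg X (φ'.equiv a)) {H₅ : Type*}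
    (K : Diagram (Xᶜ : Set Y) H₅) :
    (g.sum h).IsReduction φ.glue (Set.range (Sum.map α β)) K ↔ IsGluing φ' K := by
  rw [isGluing_iff, (hα.sumMap hβ).isReduction_iff φ.isPairing_glue φ'.isPairing_glue
    (glue_comm hα hβ hφ)]

/-- `glue` takes a leg of `g` to a leg of `h` and vice versa. If it preserves the chosen part, a leg
in the range of `α` has its partner in the range of `β`, and conversely. -/
theorem exists_restrict (hα : g'.IsEmb g α) (hβ : h'.IsEmb h β) (φ : Matching X g h)
    (hU : ∀ s ∈ Set.range (Sum.map α β), φ.glue s ∈ Set.range (Sum.map α β)) :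
    ∃ φ' : Matching X g' h', ∀ a, φ.equiv (hα.leg X a) = hβ.leg X (φ'.equiv a) := by
  have h1 : ∀ a, ∃ b, hβ.leg X b = φ.equiv (hα.leg X a) := fun a => by
    refine hβ.exists_leg_eq X _ ?_
    obtain ⟨s | s, hs⟩ := hU (.inl (α a.half)) ⟨.inl a.half, rfl⟩
    · rw [← hα.half_leg, φ.glue_inl] at hs
      cases hs
    · rw [← hα.half_leg, φ.glue_inl] at hs
      exact ⟨s, Sum.inr_injective hs⟩
  have h2 : ∀ b, ∃ a, hα.leg X a = φ.equiv.symm (hβ.leg X b) := fun b => by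
    refine hα.exists_leg_eq X _ ?_
    obtain ⟨s | s, hs⟩ := hU (.inr (β b.half)) ⟨.inr b.half, rfl⟩
    · rw [← hβ.half_leg, φ.glue_inr] at hs
      exact ⟨s, Sum.inl_injective hs⟩
    · rw [← hβ.half_leg, φ.glue_inr] at hs
      cases hs
  choose f hf using h1
  choose f' hf' using h2
  refine ⟨⟨⟨f, f', fun a => hα.leg_injective X ?_, fun b => hβ.leg_injective X ?_⟩,
    fun a => ?_⟩, fun a => (hf a).symm⟩
  · rw [hf', hf, Equiv.symm_apply_apply]
  · rw [hf, hf', Equiv.apply_symm_apply]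
  · change h'.legColour X (f a) = _
    rw [← hβ.legColour_leg X, hf, φ.legColour_equiv, hα.legColour_leg]

end Restrict

section Splitting

variable {G₁ G₂ K₁ K₂ : Type*} {g₁ : Diagram Y G₁} {g₂ : Diagram Y G₂} {h₁ : Diagram Y K₁}
  {h₂ : Diagram Y K₂} {α₁ : G₁ → H₁} {α₂ : G₂ → H₁} {β₁ : K₁ → H₂} {β₂ : K₂ → H₂}

/-- The matching that is composed of matchings between complementary parts. -/
noncomputable def Matching.union (hα₁ : g₁.IsEmb g α₁) (hα₂ : g₂.IsEmb g α₂)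
    (hα : Set.range α₂ = (Set.range α₁)ᶜ) (hβ₁ : h₁.IsEmb h β₁) (hβ₂ : h₂.IsEmb h β₂)
    (hβ : Set.range β₂ = (Set.range β₁)ᶜ) (φ₁ : Matching X g₁ h₁) (φ₂ : Matching X g₂ h₂) :
    Matching X g h :=
  ⟨((legSplit hα₁ hα₂ hα X).symm.trans (Equiv.sumCongr φ₁.1 φ₂.1)).trans
    (legSplit hβ₁ hβ₂ hβ X), fun a => by
      obtain ⟨a | a, rfl⟩ := (legSplit hα₁ hα₂ hα X).surjective a
      · simp only [Equiv.trans_apply, Equiv.symm_apply_apply, Equiv.sumCongr_apply, Sum.map_inl]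
        exact (hβ₁.legColour_leg X _).trans ((φ₁.2 a).trans (hα₁.legColour_leg X a).symm)
      · simp only [Equiv.trans_apply, Equiv.symm_apply_apply, Equiv.sumCongr_apply, Sum.map_inr]
        exact (hβ₂.legColour_leg X _).trans ((φ₂.2 a).trans (hα₂.legColour_leg X a).symm)⟩

theorem range_sumMap_compl (hα : Set.range α₂ = (Set.range α₁)ᶜ)
    (hβ : Set.range β₂ = (Set.range β₁)ᶜ) :
    Set.range (Sum.map α₂ β₂) = (Set.range (Sum.map α₁ β₁))ᶜ := by
  ext s
  rcases s with a | b
  · have := Set.ext_iff.1 hα a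
    simpa using this
  · have := Set.ext_iff.1 hβ b
    simpa using this

/-- The gluings of two diagrams that respect given decompositions into complementary parts. -/
theorem card_matching_splitting (hα₁ : g₁.IsEmb g α₁) (hα₂ : g₂.IsEmb g α₂)
    (hα : Set.range α₂ = (Set.range α₁)ᶜ) (hβ₁ : h₁.IsEmb h β₁) (hβ₂ : h₂.IsEmb h β₂)
    (hβ : Set.range β₂ = (Set.range β₁)ᶜ) {L₁ L₂ : Type*} (E₁ : Diagram (Xᶜ : Set Y) L₁)
    (E₂ : Diagram (Xᶜ : Set Y) L₂) {U : Set (H₁ ⊕ H₂)} (hU : U = Set.range (Sum.map α₁ β₁)) :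
    Nat.card {φ : Matching X g h // (g.sum h).IsPairClosed φ.glue U ∧
      (g.sum h).IsReduction φ.glue U E₁ ∧ (g.sum h).IsReduction φ.glue Uᶜ E₂} =
    Nat.card {φ : Matching X g₁ h₁ // IsGluing φ E₁} *
      Nat.card {φ : Matching X g₂ h₂ // IsGluing φ E₂} := by
  subst hU
  have hU' := range_sumMap_compl hα hβ
  set F := Matching.union (X := X) hα₁ hα₂ hα hβ₁ hβ₂ hβ with hF
  have hF₁ : ∀ φ₁ φ₂ a, (F φ₁ φ₂).equiv (hα₁.leg X a) = hβ₁.leg X (φ₁.equiv a) := fun φ₁ φ₂ a => by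
    change legSplit hβ₁ hβ₂ hβ X (Sum.map _ _ ((legSplit hα₁ hα₂ hα X).symm
      (legSplit hα₁ hα₂ hα X (Sum.inl a)))) = _
    rw [Equiv.symm_apply_apply]
    rfl
  have hF₂ : ∀ φ₁ φ₂ a, (F φ₁ φ₂).equiv (hα₂.leg X a) = hβ₂.leg X (φ₂.equiv a) := fun φ₁ φ₂ a => by
    change legSplit hβ₁ hβ₂ hβ X (Sum.map _ _ ((legSplit hα₁ hα₂ hα X).symm
      (legSplit hα₁ hα₂ hα X (Sum.inr a)))) = _
    rw [Equiv.symm_apply_apply]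
    rfl
  have hred₁ : ∀ φ₁ φ₂, (g.sum h).IsReduction (F φ₁ φ₂).glue (Set.range (Sum.map α₁ β₁)) E₁ ↔
      IsGluing φ₁ E₁ := fun φ₁ φ₂ => isReduction_range_iff hα₁ hβ₁ (hF₁ φ₁ φ₂) E₁
  have hred₂ : ∀ φ₁ φ₂, (g.sum h).IsReduction (F φ₁ φ₂).glue (Set.range (Sum.map α₁ β₁))ᶜ E₂ ↔
      IsGluing φ₂ E₂ := fun φ₁ φ₂ =>
    hU' ▸ isReduction_range_iff hα₂ hβ₂ (hF₂ φ₁ φ₂) E₂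
  have hclosed : ∀ φ₁ φ₂, (g.sum h).IsPairClosed (F φ₁ φ₂).glue (Set.range (Sum.map α₁ β₁)) := by
    refine fun φ₁ φ₂ => ⟨(hα₁.sumMap hβ₁).isClosed_range, ?_⟩
    rintro _ ⟨s, rfl⟩
    exact ⟨_, glue_comm hα₁ hβ₁ (hF₁ φ₁ φ₂) s⟩
  rw [← Nat.card_prod]
  symm
  refine Nat.card_congr (Equiv.ofBijective (fun p => ⟨F p.1.1 p.2.1, hclosed _ _,
    (hred₁ _ _).2 p.1.2, (hred₂ _ _).2 p.2.2⟩) ⟨?_, ?_⟩)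
  · rintro ⟨⟨φ₁, k₁⟩, φ₂, k₂⟩ ⟨⟨ψ₁, l₁⟩, ψ₂, l₂⟩ heq
    have heq : F φ₁ φ₂ = F ψ₁ ψ₂ := congrArg Subtype.val heq
    have e₁ : φ₁ = ψ₁ := Matching.ext fun a => hβ₁.leg_injective X
      (by rw [← hF₁ φ₁ φ₂, heq, hF₁])
    have e₂ : φ₂ = ψ₂ := Matching.ext fun a => hβ₂.leg_injective X
      (by rw [← hF₂ φ₁ φ₂, heq, hF₂])
    subst e₁
    subst e₂
    rfl
  · rintro ⟨φ, k, k₁, k₂⟩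
    obtain ⟨φ₁, hφ₁⟩ := exists_restrict hα₁ hβ₁ φ k.pair
    obtain ⟨φ₂, hφ₂⟩ := exists_restrict hα₂ hβ₂ φ (by
      rw [hU']
      exact (k.compl φ.isPairing_glue).pair)
    -- Every leg lies in one of the two parts, so the two restrictions determine the matching.
    have hφ : F φ₁ φ₂ = φ := by
      refine Matching.ext fun a => ?_
      obtain ⟨a | a, rfl⟩ := (legSplit hα₁ hα₂ hα X).surjective a
      · exact (hF₁ φ₁ φ₂ a).trans (hφ₁ a).symm
      · exact (hF₂ φ₁ φ₂ a).trans (hφ₂ a).symm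
    refine ⟨⟨⟨φ₁, (hred₁ φ₁ φ₂).1 (hφ ▸ k₁)⟩, φ₂, (hred₂ φ₁ φ₂).1 (hφ ▸ k₂)⟩, Subtype.ext hφ⟩

end Splitting

end UniTri

/-! ### Coefficients of the exponential of a primitive series -/

namespace UniTri

open Diagram

variable {Y : Type u}

/-- A primitive series is linear in the connected graphs, so its partial derivatives are constants.
-/
theorem pderiv_of_isPrimitive {f : DSeries Y} (hf : IsPrimitive f) (i : Conn Y) :
    MvPowerSeries.pderiv ℚ i f =
      MvPowerSeries.C (MvPowerSeries.coeff (Finsupp.single i 1) f) := by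
  classical
  ext n
  rw [MvPowerSeries.coeff_pderiv, MvPowerSeries.coeff_C]
  split_ifs with hn
  · simp [hn]
  · have : MvPowerSeries.coeff (n + Finsupp.single i 1) f = 0 := by
      by_contra h
      obtain ⟨j, hj⟩ := hf _ h
      have h1 := congrArg Finsupp.degree hj
      rw [map_add, Finsupp.degree_single, Finsupp.degree_single, Nat.add_eq_right,
        Finsupp.degree_eq_zero_iff] at h1
      exact hn h1
    rw [this, zero_mul]

theorem degree_eq_of_coeff_pow_ne_zero {f : DSeries Y} (hf : IsPrimitive f) (d : ℕ) (m : Graph Y)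
    (hm : MvPowerSeries.coeff m (f ^ d) ≠ 0) : Finsupp.degree m = d := by
  classical
  induction d generalizing m with
  | zero =>
    rw [pow_zero, MvPowerSeries.coeff_one] at hm
    have : m = 0 := by
      by_contra h
      exact hm (if_neg h)
    simp [this]
  | succ d ih =>
    rw [pow_succ, MvPowerSeries.coeff_mul] at hm
    obtain ⟨p, hp, hne⟩ := Finset.exists_ne_zero_of_sum_ne_zero hm
    rw [Finset.HasAntidiagonal.mem_antidiagonal] at hp
    obtain ⟨i, hi⟩ := hf _ (right_ne_zero_of_mul hne)
    rw [← hp, map_add, ih _ (left_ne_zero_of_mul hne), hi, Finsupp.degree_single]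

/-- The power `f ^ d` is homogeneous of degree `d` in the connected graphs, so only one term of the
exponential series contributes. -/
theorem coeff_expSeries_eq_pow {f : DSeries Y} (hf : IsPrimitive f) (m : Graph Y) :
    MvPowerSeries.coeff m (expSeries f) =
      ((Finsupp.degree m).factorial : ℚ)⁻¹ * MvPowerSeries.coeff m (f ^ Finsupp.degree m) := by
  have h0 : MvPowerSeries.constantCoeff f = 0 := by
    by_contra h
    rw [← MvPowerSeries.coeff_zero_eq_constantCoeff_apply] at h
    obtain ⟨i, hi⟩ := hf _ h
    exact Finsupp.single_ne_zero.2 one_ne_zero hi.symm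
  rw [expSeries, PowerSeries.coeff_subst (PowerSeries.HasSubst.of_constantCoeff_zero h0),
    finsum_eq_single _ (Finsupp.degree m), PowerSeries.coeff_exp, smul_eq_mul]
  · simp
  · intro d hd
    by_contra h
    exact hd (degree_eq_of_coeff_pow_ne_zero hf d m (right_ne_zero_of_smul h)).symm

theorem coeff_zero_expSeries {f : DSeries Y} (hf : IsPrimitive f) :
    MvPowerSeries.coeff 0 (expSeries f) = 1 := by
  rw [coeff_expSeries_eq_pow hf]
  simp

/-- This is the differential equation ∂ᵢ exp f = bᵢ exp f, read off from the derivative of a power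
of `f`. As a recursion in `m` it takes the place of the multinomial theorem. -/
theorem coeff_expSeries_add_single {f : DSeries Y} (hf : IsPrimitive f) (m : Graph Y)
    (i : Conn Y) :
    MvPowerSeries.coeff (m + Finsupp.single i 1) (expSeries f) * (m i + 1) =
      MvPowerSeries.coeff (Finsupp.single i 1) f * MvPowerSeries.coeff m (expSeries f) := by
  have h := congrArg (MvPowerSeries.coeff m)
    (MvPowerSeries.pderiv_pow (R := ℚ) (i := i) f (Finsupp.degree m + 1))
  rw [MvPowerSeries.coeff_pderiv, pderiv_of_isPrimitive hf, Nat.add_sub_cancel, mul_assoc,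
    ← map_natCast (MvPowerSeries.C (σ := Conn Y) (R := ℚ)), MvPowerSeries.coeff_C_mul,
    MvPowerSeries.coeff_mul_C] at h
  have hd : Finsupp.degree (m + Finsupp.single i 1) = Finsupp.degree m + 1 := by
    rw [map_add, Finsupp.degree_single]
  rw [coeff_expSeries_eq_pow hf, coeff_expSeries_eq_pow hf, hd, mul_assoc, h, Nat.factorial_succ]
  have := Nat.factorial_ne_zero (Finsupp.degree m)
  push_cast
  field_simp

theorem induction_add_single {ι : Type*} {P : (ι →₀ ℕ) → Prop} (h0 : P 0)
    (h1 : ∀ i m, P m → P (m + Finsupp.single i 1)) (m : ι →₀ ℕ) : P m := by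
  induction m using Finsupp.induction with
  | zero => exact h0
  | single_add i b m _ _ ih =>
    clear * - ih h1
    rw [add_comm]
    induction b with
    | zero => simpa using ih
    | succ b ihb =>
      rw [Finsupp.single_add, ← add_assoc]
      exact h1 i _ ihb

theorem multFact_add_single {ι : Type*} (m : ι →₀ ℕ) (i : ι) :
    multFact (m + Finsupp.single i 1) = (m i + 1) * multFact m := by
  classical
  have h : ∀ j ∈ insert i m.support, (((m + Finsupp.single i 1 : ι →₀ ℕ) j).factorial : ℚ) =
      (if j = i then (m i + 1 : ℚ) else 1) * ((m j).factorial : ℚ) := by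
    intro j _
    split_ifs with hj
    · subst hj
      rw [Finsupp.add_apply, Finsupp.single_eq_same, Nat.factorial_succ]
      push_cast
      rfl
    · rw [Finsupp.add_apply, Finsupp.single_eq_of_ne hj, add_zero, one_mul]
  have h1 : multFact (m + Finsupp.single i 1) =
      ∏ j ∈ insert i m.support, (((m + Finsupp.single i 1 : ι →₀ ℕ) j).factorial : ℚ) := by
    refine Finsupp.prod_of_support_subset _ (fun j hj => ?_) _ fun _ _ => by simp
    rw [Finset.mem_insert, Finsupp.mem_support_iff]
    by_contra! hc
    rw [Finsupp.mem_support_iff, Finsupp.add_apply, Finsupp.single_eq_of_ne hc.1, hc.2] at hj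
    exact hj rfl
  have h2 : multFact m = ∏ j ∈ insert i m.support, ((m j).factorial : ℚ) :=
    Finsupp.prod_of_support_subset _ (Finset.subset_insert _ _) _ fun _ _ => by simp
  rw [h1, h2, Finset.prod_congr rfl h, Finset.prod_mul_distrib, Finset.prod_ite_eq',
    if_pos (Finset.mem_insert_self _ _)]

theorem multFact_zero {ι : Type*} : multFact (0 : ι →₀ ℕ) = 1 := Finsupp.prod_zero_index

/-- The monomial with exponents `m`. -/
noncomputable def multPow {ι : Type*} (x : ι → ℚ) (m : ι →₀ ℕ) : ℚ :=
  m.prod fun i n => x i ^ n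

theorem multPow_add {ι : Type*} (x : ι → ℚ) (m n : ι →₀ ℕ) :
    multPow x (m + n) = multPow x m * multPow x n := by
  classical
  exact Finsupp.prod_add_index' (fun _ => pow_zero _) fun _ _ _ => pow_add _ _ _

theorem multPow_zero {ι : Type*} (x : ι → ℚ) : multPow x 0 = 1 := Finsupp.prod_zero_index

theorem multPow_single {ι : Type*} (x : ι → ℚ) (i : ι) : multPow x (Finsupp.single i 1) = x i :=
  (Finsupp.prod_single_index (h := fun i n => x i ^ n) (pow_zero _)).trans (pow_one _)

/-- The coefficients of the exponential of a primitive series. -/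
theorem coeff_expSeries {f : DSeries Y} (hf : IsPrimitive f) (m : Graph Y) :
    multFact m * MvPowerSeries.coeff m (expSeries f) =
      multPow (fun i => MvPowerSeries.coeff (Finsupp.single i 1) f) m := by
  induction m using induction_add_single with
  | h0 => rw [multFact_zero, coeff_zero_expSeries hf, multPow_zero, one_mul]
  | h1 i m ih =>
    rw [multPow_add, ← ih, multFact_add_single, multPow_single]
    linear_combination multFact m * coeff_expSeries_add_single hf m i

theorem coeff_expSeries_mul {f : DSeries Y} (hf : IsPrimitive f) (m n : Graph Y) :
    multFact m * multFact n * (MvPowerSeries.coeff m (expSeries f) *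
      MvPowerSeries.coeff n (expSeries f)) =
      multFact (m + n) * MvPowerSeries.coeff (m + n) (expSeries f) := by
  rw [coeff_expSeries hf, multPow_add, ← coeff_expSeries hf, ← coeff_expSeries hf]
  ring

end UniTri

/-! ### The double count of split gluings -/

namespace UniTri

open Diagram

variable {Y : Type u} {X : Set Y}

noncomputable instance fintypeSetSigma {ι : Type*} (m : ι →₀ ℕ) :
    Fintype (Set (Σ i, Fin (m i))) :=
  Fintype.ofFinite _

instance finite_matching {H₁ : Type v} {H₂ : Type w} [Finite H₁] [Finite H₂]
    (g : Diagram Y H₁) (h : Diagram Y H₂) : Finite (Matching X g h) := by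
  have : Finite (g.LegIn X) := inferInstanceAs (Finite (Subtype _))
  have : Finite (h.LegIn X) := inferInstanceAs (Finite (Subtype _))
  exact inferInstanceAs (Finite (Subtype _))

/-- The half-edges of two sets of components. -/
def Graph.blocks {m n : Graph Y} (p : Set (Σ i, Fin (m i)) × Set (Σ i, Fin (n i))) :
    Set (m.Half ⊕ n.Half) :=
  {s | Sum.elim (· ∈ Graph.block p.1) (· ∈ Graph.block p.2) s}

theorem Graph.blocks_injective {m n : Graph Y} :
    Function.Injective (Graph.blocks (m := m) (n := n)) := by
  rintro ⟨S, T⟩ ⟨S', T'⟩ h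
  refine Prod.ext (block_injective (Set.ext fun a => ?_)) (block_injective (Set.ext fun a => ?_))
  · exact Set.ext_iff.1 h (.inl a)
  · exact Set.ext_iff.1 h (.inr a)

theorem Graph.exists_blocks_eq {m n : Graph Y} {U : Set (m.Half ⊕ n.Half)}
    (hU : (m.diagram.sum n.diagram).IsClosed U) : ∃ p, Graph.blocks p = U := by
  obtain ⟨S, hS⟩ := exists_block_eq (m := m) (V := Sum.inl ⁻¹' U)
    ⟨fun a ha => hU.rot _ ha, fun a ha => hU.opp _ ha⟩
  obtain ⟨T, hT⟩ := exists_block_eq (m := n) (V := Sum.inr ⁻¹' U)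
    ⟨fun a ha => hU.rot _ ha, fun a ha => hU.opp _ ha⟩
  refine ⟨(S, T), ?_⟩
  ext (a | a)
  · exact Set.ext_iff.1 hS a
  · exact Set.ext_iff.1 hT a

/-- `p` decomposes the gluing `φ` of `m` and `n` into a gluing with result `k` and a gluing with
result `l`. -/
def IsSplitting {m n : Graph Y} (k l : Graph (Xᶜ : Set Y))
    (p : Set (Σ i, Fin (m i)) × Set (Σ i, Fin (n i))) (φ : Matching X m.diagram n.diagram) : Prop :=
  (m.diagram.sum n.diagram).IsPairClosed φ.glue (Graph.blocks p) ∧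
    (m.diagram.sum n.diagram).IsReduction φ.glue (Graph.blocks p) k.diagram ∧
    (m.diagram.sum n.diagram).IsReduction φ.glue (Graph.blocks p)ᶜ l.diagram

theorem card_isSplitting_left {m n : Graph Y} (k l : Graph (Xᶜ : Set Y))
    (p : Set (Σ i, Fin (m i)) × Set (Σ i, Fin (n i))) :
    Nat.card {φ : Matching X m.diagram n.diagram // IsSplitting k l p φ} =
      gluingNumber X (mult p.1) (mult p.2) k * gluingNumber X (mult p.1ᶜ) (mult p.2ᶜ) l := by
  obtain ⟨S, T⟩ := p
  obtain ⟨α₁, hα₁, rα₁⟩ := Graph.copy_mult S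
  obtain ⟨α₂, hα₂, rα₂⟩ := Graph.copy_mult Sᶜ
  obtain ⟨β₁, hβ₁, rβ₁⟩ := Graph.copy_mult T
  obtain ⟨β₂, hβ₂, rβ₂⟩ := Graph.copy_mult Tᶜ
  refine card_matching_splitting hα₁ hα₂ (by rw [rα₁, rα₂]; rfl) hβ₁ hβ₂ (by rw [rβ₁, rβ₂]; rfl)
    _ _ ?_
  ext (a | a)
  · change a ∈ Graph.block S ↔ _
    rw [← rα₁]
    simp
  · change a ∈ Graph.block T ↔ _
    rw [← rβ₁]
    simp

theorem card_isSplitting_right {m n : Graph Y} (k l : Graph (Xᶜ : Set Y))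
    (φ : Matching X m.diagram n.diagram) [Decidable (IsGluing φ (k + l).diagram)] :
    Nat.card {p : Set (Σ i, Fin (m i)) × Set (Σ i, Fin (n i)) // IsSplitting k l p φ} =
      if IsGluing φ (k + l).diagram then
        {S : Set (Σ i, Fin ((k + l) i)) | mult S = k}.ncard else 0 := by
  split_ifs with hφ
  · rw [isGluing_iff] at hφ
    obtain ⟨e, he⟩ := hφ
    rw [← Graph.ncard_copy (k + l) k l rfl, ← he.ncard_splittings φ.isPairing_glue,
      ← Nat.card_coe_set_eq]
    refine Nat.card_congr (Equiv.ofBijective (fun p => ⟨Graph.blocks p.1, p.2⟩) ⟨?_, ?_⟩)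
    · exact fun p q h => Subtype.ext (Graph.blocks_injective (congrArg Subtype.val h))
    · rintro ⟨U, hU⟩
      obtain ⟨p, rfl⟩ := Graph.exists_blocks_eq hU.1.toIsClosed
      exact ⟨⟨p, hU⟩, rfl⟩
  · have : IsEmpty {p : Set (Σ i, Fin (m i)) × Set (Σ i, Fin (n i)) // IsSplitting k l p φ} := by
      refine ⟨fun ⟨p, h1, h2, h3⟩ => hφ ?_⟩
      -- If the parts reduce to `k` and `l`, the whole reduces to their disjoint union `k + l`. This
      -- needs some division of `k + l` into `k` and `l`; their number is nonzero by the factorial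
      -- formula.
      have hne : {S : Set (Σ i, Fin ((k + l) i)) | mult S = k}.Nonempty := by
        by_contra hne
        rw [Set.not_nonempty_iff_eq_empty] at hne
        have := ncard_mult_eq (k + l) k l rfl
        rw [hne, Set.ncard_empty, Nat.cast_zero, zero_mul] at this
        exact multFact_ne_zero _ this.symm
      obtain ⟨S, hS : mult S = k⟩ := hne
      have hS' : mult Sᶜ = l := by
        have := mult_add_mult_compl S
        rw [hS] at this
        exact add_left_cancel this
      rw [isGluing_iff]
      exact h2.union h3 (Graph.copy_iff.2 hS) (Graph.block_compl S ▸ Graph.copy_iff.2 hS')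
    exact Nat.card_of_isEmpty

/-- Both sides count the pairs of a matching and a division that it respects, with results `k` and
`l`: the left side division by division, the right side matching by matching. -/
theorem sum_gluingNumber_mult (m n : Graph Y) (k l : Graph (Xᶜ : Set Y)) :
    ∑ p : Set (Σ i, Fin (m i)) × Set (Σ i, Fin (n i)),
      gluingNumber X (mult p.1) (mult p.2) k * gluingNumber X (mult p.1ᶜ) (mult p.2ᶜ) l =
    {S : Set (Σ i, Fin ((k + l) i)) | mult S = k}.ncard * gluingNumber X m n (k + l) := by
  classical
  have : Fintype (Matching X m.diagram n.diagram) := Fintype.ofFinite _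
  simp_rw [← card_isSplitting_left]
  rw [← Nat.card_sigma, ← Nat.card_congr (Equiv.subtypeProdEquivSigmaSubtype _),
    ← Nat.card_congr ((Equiv.prodComm _ _).subtypeEquiv fun q => (Iff.rfl :
      IsSplitting k l q.2 q.1 ↔ _)), Nat.card_congr (Equiv.subtypeProdEquivSigmaSubtype
        fun (φ : Matching X m.diagram n.diagram) p => IsSplitting k l p φ), Nat.card_sigma]
  simp_rw [card_isSplitting_right]
  rw [← Finset.sum_filter, Finset.sum_const, smul_eq_mul, mul_comm, gluingNumber,
    Nat.card_eq_fintype_card, Fintype.card_subtype]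

/-- Summation over the sets of components of a graph, in terms of their multiplicities. -/
theorem sum_mult {ι : Type*} [DecidableEq ι] (m : ι →₀ ℕ) (F : (ι →₀ ℕ) → (ι →₀ ℕ) → ℚ) :
    ∑ S : Set (Σ i, Fin (m i)), F (mult S) (mult Sᶜ) =
      ∑ p ∈ Finset.HasAntidiagonal.antidiagonal m,
        multFact m / (multFact p.1 * multFact p.2) * F p.1 p.2 := by
  classical
  rw [← Finset.sum_fiberwise_of_maps_to (s := Finset.univ)
    (t := Finset.HasAntidiagonal.antidiagonal m)
    (g := fun S : Set (Σ i, Fin (m i)) => (mult S, mult Sᶜ))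
    fun S _ => Finset.HasAntidiagonal.mem_antidiagonal.2 (mult_add_mult_compl S)]
  refine Finset.sum_congr rfl fun p hp => ?_
  rw [Finset.HasAntidiagonal.mem_antidiagonal] at hp
  have hcard : ({S : Set (Σ i, Fin (m i)) | (mult S, mult Sᶜ) = p} : Finset _).card =
      {S : Set (Σ i, Fin (m i)) | mult S = p.1}.ncard := by
    rw [← Set.ncard_coe_finset]
    congr 1
    ext S
    simp only [Finset.coe_filter, Finset.mem_univ, true_and, Set.mem_ofPred_eq]
    refine ⟨fun h => congrArg Prod.fst h, fun h => Prod.ext h ?_⟩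
    have := mult_add_mult_compl S
    rw [h] at this
    exact add_left_cancel (this.trans hp.symm)
  rw [Finset.sum_congr rfl (g := fun _ => F p.1 p.2), Finset.sum_const, hcard, nsmul_eq_mul]
  · congr 1
    rw [eq_div_iff (mul_ne_zero (multFact_ne_zero _) (multFact_ne_zero _))]
    exact ncard_mult_eq m p.1 p.2 hp
  · intro S hS
    rw [← (Finset.mem_filter.1 hS).2]

open Classical in
/-- The gluings of `m` and `n` with result `k + l`, in terms of gluings with results `k` and `l`. -/
theorem sum_gluingTerm {B C : DSeries Y} (hB : IsPrimitive B) (hC : IsPrimitive C)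
    (m n : Graph Y) (k l : Graph (Xᶜ : Set Y)) :
    ∑ q ∈ Finset.HasAntidiagonal.antidiagonal m ×ˢ Finset.HasAntidiagonal.antidiagonal n,
      gluingTerm X (expSeries B) (expSeries C) k (q.1.1, q.2.1) *
        gluingTerm X (expSeries B) (expSeries C) l (q.1.2, q.2.2) =
    multFact (k + l) / (multFact k * multFact l) *
      gluingTerm X (expSeries B) (expSeries C) (k + l) (m, n) := by
  have h1 := congrArg (Nat.cast (R := ℚ)) (sum_gluingNumber_mult m n k l)
  have h2 : ({S : Set (Σ i, Fin ((k + l) i)) | mult S = k}.ncard : ℚ) =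
      multFact (k + l) / (multFact k * multFact l) := by
    rw [eq_div_iff (mul_ne_zero (multFact_ne_zero _) (multFact_ne_zero _))]
    exact ncard_mult_eq (k + l) k l rfl
  simp only [Nat.cast_sum, Nat.cast_mul] at h1
  rw [h2, Fintype.sum_prod_type] at h1
  rw [Finset.sum_congr rfl fun S _ => sum_mult n fun a b =>
    (gluingNumber X (mult S) a k : ℚ) * (gluingNumber X (mult Sᶜ) b l : ℚ)] at h1
  rw [sum_mult m fun c d => ∑ p ∈ Finset.HasAntidiagonal.antidiagonal n, multFact n /
    (multFact p.1 * multFact p.2) * ((gluingNumber X c p.1 k : ℚ) * (gluingNumber X d p.2 l : ℚ))]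
    at h1
  rw [gluingTerm, mul_left_comm, ← h1, Finset.sum_product, Finset.mul_sum]
  refine Finset.sum_congr rfl fun p hp => ?_
  rw [Finset.mul_sum, Finset.mul_sum]
  refine Finset.sum_congr rfl fun q hq => ?_
  rw [Finset.HasAntidiagonal.mem_antidiagonal] at hp hq
  have e1 := coeff_expSeries_mul hB p.1 p.2
  have e2 := coeff_expSeries_mul hC q.1 q.2
  rw [hp] at e1
  rw [hq] at e2
  have := multFact_ne_zero p.1
  have := multFact_ne_zero p.2
  have := multFact_ne_zero q.1
  have := multFact_ne_zero q.2
  simp only [gluingTerm]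
  field_simp
  linear_combination (MvPowerSeries.coeff q.1 (expSeries C) * MvPowerSeries.coeff q.2 (expSeries C)
    * multFact q.1 * multFact q.2 * gluingNumber X p.1 q.1 k * gluingNumber X p.2 q.2 l) * e1 +
    (MvPowerSeries.coeff m (expSeries B) * multFact m *
      gluingNumber X p.1 q.1 k * gluingNumber X p.2 q.2 l) * e2

/-- The product of the two sums is regrouped according to the disjoint unions `m` and `n` of the
graphs on either side; each group is evaluated by `sum_gluingTerm`. -/
theorem finsum_gluingTerm_mul {B C : DSeries Y} (hB : IsPrimitive B) (hC : IsPrimitive C)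
    (hdef : GluingDefined X (expSeries B) (expSeries C)) (k l : Graph (Xᶜ : Set Y)) :
    MvPowerSeries.coeff k (gluing X (expSeries B) (expSeries C)) *
      MvPowerSeries.coeff l (gluing X (expSeries B) (expSeries C)) =
    multFact (k + l) / (multFact k * multFact l) *
      MvPowerSeries.coeff (k + l) (gluing X (expSeries B) (expSeries C)) := by
  classical
  set t := gluingTerm X (expSeries B) (expSeries C) with ht
  set A := (hdef k).toFinset with hA
  set A' := (hdef l).toFinset with hA'
  -- One finite index set for both sides: it contains the support for `k + l` and all sums of pairs
  -- from the supports for `k` and `l`.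
  set R := (hdef (k + l)).toFinset ∪ (A ×ˢ A').image fun p => p.1 + p.2 with hR
  have hZ : ∀ j (s : Finset (Graph Y × Graph Y)), Function.support (t j) ⊆ s →
      MvPowerSeries.coeff j (gluing X (expSeries B) (expSeries C)) = ∑ p ∈ s, t j p :=
    fun j s hs => finsum_eq_sum_of_support_subset _ hs
  rw [hZ k A (by simp [hA, ht]), hZ l A' (by simp [hA', ht]), hZ (k + l) R (by
    intro p hp
    rw [hR, Finset.coe_union]
    exact Or.inl (by simpa using hp)), Finset.sum_mul_sum, ← Finset.sum_product',
    ← Finset.sum_fiberwise_of_maps_to (t := R) (g := fun p => p.1 + p.2)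
      (fun p hp => Finset.mem_union_right _ (Finset.mem_image_of_mem _ hp)), Finset.mul_sum]
  refine Finset.sum_congr rfl fun r _ => ?_
  obtain ⟨m, n⟩ := r
  rw [← sum_gluingTerm hB hC]
  -- The middle two entries change places. Decompositions of `m` and `n` that are not reached lie
  -- outside the supports and contribute zero.
  refine Finset.sum_of_injOn (fun q => ((q.1.1, q.2.1), (q.1.2, q.2.2))) ?_ ?_ ?_ ?_
  · rintro ⟨⟨a, b⟩, c, d⟩ - ⟨⟨a', b'⟩, c', d'⟩ - h
    simp only [Prod.mk.injEq] at h ⊢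
    tauto
  · rintro ⟨⟨a, b⟩, c, d⟩ h
    have h := (Finset.mem_filter.1 h).2
    simp only [Prod.mk_add_mk, Prod.mk.injEq] at h
    simp [h.1, h.2]
  · rintro ⟨⟨a, c⟩, b, d⟩ h h'
    by_contra hne
    refine h' ⟨((a, b), (c, d)), ?_, rfl⟩
    simp only [Finset.mem_product, Finset.HasAntidiagonal.mem_antidiagonal] at h
    rw [Finset.mem_coe, Finset.mem_filter, Finset.mem_product]
    refine ⟨⟨?_, ?_⟩, by rw [Prod.mk_add_mk, h.1, h.2]⟩
    · exact (hdef k).mem_toFinset.2 (left_ne_zero_of_mul hne)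
    · exact (hdef l).mem_toFinset.2 (right_ne_zero_of_mul hne)
  · intro q _
    rfl

end UniTri

/-! ### Definedness: bounds on the graphs that can be glued to a given one -/

namespace UniTri

open Diagram

variable {Y : Type u} {X : Set Y}

instance finite_diagram [Finite Y] (n : ℕ) : Finite (Diagram Y (Fin n)) := by
  classical
  have : Function.Injective fun D : Diagram Y (Fin n) => (D.rot, D.opp,
      fun a => if h : D.rot a = a then some (D.colour a h) else none) := by
    rintro ⟨r, hr, o, ho, ho', c⟩ ⟨r', hr', o', h1, h2, c'⟩ h
    simp only [Prod.mk.injEq] at h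
    obtain ⟨rfl, rfl, h⟩ := h
    have : c = c' := by
      funext a ha
      have := congrFun h a
      simpa [ha] using this
    subst this
    rfl
  exact Finite.of_injective _ this

theorem finite_conn_size_le [Finite Y] (M : ℕ) : {i : Conn Y | i.size ≤ M}.Finite := by
  have : Function.Injective fun i : {i : Conn Y | i.size ≤ M} =>
      (⟨⟨i.1.size, Nat.lt_succ_of_le i.2⟩, i.1.rep⟩ :
        Σ n : Fin (M + 1), Diagram Y (Fin n)) := by
    rintro ⟨i, hi⟩ ⟨j, hj⟩ h
    refine Subtype.ext ?_
    change i = j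
    rw [← Quotient.out_eq i, ← Quotient.out_eq j]
    congr 1
    have h1 : ∀ x y : NumberedConn Y, x.1 = y.1 → HEq x.2.1 y.2.1 → x = y := by
      rintro ⟨n, D, hD⟩ ⟨n', D', hD'⟩ h h'
      obtain rfl : n = n' := h
      obtain rfl : D = D' := eq_of_heq h'
      rfl
    have h2 := Sigma.mk.inj_iff.1 h
    exact h1 _ _ (congrArg Fin.val h2.1) h2.2
  exact Set.finite_coe_iff.1 (Finite.of_injective _ this)

theorem Graph.size_le_card_half {m : Graph Y} {i : Conn Y} (hi : m i ≠ 0) :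
    i.size ≤ Nat.card m.Half := by
  have h := Nat.card_le_card_of_injective _
    (Graph.isEmb_incl (m := m) ⟨i, ⟨0, Nat.pos_of_ne_zero hi⟩⟩).inj
  rwa [Nat.card_eq_fintype_card (α := Fin _), Fintype.card_fin] at h

theorem Graph.le_card_half (m : Graph Y) (i : Conn Y) : m i ≤ Nat.card m.Half := by
  obtain ⟨a⟩ := i.rep_connected.1
  have : Function.Injective fun j : Fin (m i) => (⟨i, j, a⟩ : m.Half) := fun j j' h => by
    simpa using h
  have h := Nat.card_le_card_of_injective _ this
  rwa [Nat.card_eq_fintype_card (α := Fin _), Fintype.card_fin] at h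

/-- The number of half-edges bounds both the size of the components and their multiplicities, so `m`
lies below one fixed finitely supported function. -/
theorem finite_graph_card_half_le [Finite Y] (M : ℕ) :
    {m : Graph Y | Nat.card m.Half ≤ M}.Finite := by
  classical
  refine (Set.finite_Iic (∑ i ∈ (finite_conn_size_le (Y := Y) M).toFinset,
    Finsupp.single i M)).subset fun m (hm : _ ≤ M) i => ?_
  rw [Finsupp.finsetSum_apply]
  by_cases hi : m i = 0
  · rw [hi]
    exact Nat.zero_le _
  · refine le_trans ?_ (Finset.single_le_sum (f := fun j => Finsupp.single j M i)
      (fun _ _ => Nat.zero_le _) ((finite_conn_size_le M).mem_toFinset.2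
        ((Graph.size_le_card_half hi).trans hm)))
    rw [Finsupp.single_eq_same]
    exact (Graph.le_card_half m i).trans hm

/-- A connected diagram with an edge between two univalent vertices is a strut. -/
theorem Conn.eq_strut {i : Conn Y} {a : Fin i.size} (ha : i.rep.rot a = a)
    (hb : i.rep.rot (i.rep.opp a) = i.rep.opp a) :
    i = strut (i.rep.colour a ha) (i.rep.colour _ hb) := by
  have hf : (strutDiagram (i.rep.colour a ha) (i.rep.colour _ hb)).IsEmb i.rep
      ![a, i.rep.opp a] :=
    { inj := by
        intro x y h
        fin_cases x <;> fin_cases y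
        · rfl
        · exact absurd h.symm (i.rep.opp_ne a)
        · exact absurd h (i.rep.opp_ne a)
        · rfl
      rot := by
        intro x
        fin_cases x
        · exact ha.symm
        · exact hb.symm
      opp := by
        intro x
        fin_cases x
        · rfl
        · exact (i.rep.opp_opp a).symm
      colour := by
        intro x _ _
        fin_cases x
        · rfl
        · rfl }
  exact Conn.eq_of_isom ((hf.isom ⟨0⟩ i.rep_connected).symm.trans
    (Conn.rep_isom_of_mk (strutDiagram_connected _ _)).symm)

theorem coeff_ne_zero_of_mem {f : DSeries Y} (hf : IsPrimitive f) {m : Graph Y}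
    (hm : MvPowerSeries.coeff m (expSeries f) ≠ 0) (a : m.Half) :
    MvPowerSeries.coeff (Finsupp.single a.1 1) f ≠ 0 := by
  have h := coeff_expSeries hf m
  have h1 := mul_ne_zero (multFact_ne_zero m) hm
  rw [h, multPow, Finsupp.prod, Finset.prod_ne_zero_iff] at h1
  have ha : m a.1 ≠ 0 := fun h => (h ▸ a.2.1).elim0
  exact (pow_ne_zero_iff ha).1 (h1 a.1 (Finsupp.mem_support_iff.2 ha))

/-- An edge between two univalent vertices is a whole component, and every component of a graph in
the exponential of `f` occurs in `f`. -/
theorem coeff_strut_ne_zero {f : DSeries Y} (hf : IsPrimitive f) {m : Graph Y}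
    (hm : MvPowerSeries.coeff m (expSeries f) ≠ 0) {a b : m.diagram.LegIn X}
    (hab : m.diagram.opp a.half = b.half) :
    MvPowerSeries.coeff (Finsupp.single
      (strut (m.diagram.legColour X a) (m.diagram.legColour X b)) 1) f ≠ 0 := by
  have h1 := coeff_ne_zero_of_mem hf hm a.half
  obtain ⟨a, ha, haX⟩ := a
  obtain ⟨b, hb, hbX⟩ := b
  obtain rfl : m.diagram.opp a = b := hab
  have hinc := Graph.isEmb_incl (Graph.comp a)
  have ha' : a.1.rep.rot a.2.2 = a.2.2 := (hinc.rot_eq_iff a.2.2).1 ha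
  have hb' : a.1.rep.rot (a.1.rep.opp a.2.2) = a.1.rep.opp a.2.2 :=
    (hinc.rot_eq_iff (a.1.rep.opp a.2.2)).1 hb
  have h2 : a.1 = strut (a.1.rep.colour a.2.2 ha') (a.1.rep.colour _ hb') := Conn.eq_strut ha' hb'
  exact ne_of_eq_of_ne (congrArg (fun i => MvPowerSeries.coeff (Finsupp.single i 1) f) h2.symm) h1

section Bound

variable {B C : DSeries Y} {m n : Graph Y}

theorem Matching.exists_leg_of_glue_inl_ne {H₁ : Type v} {H₂ : Type w} {g : Diagram Y H₁}
    {h : Diagram Y H₂} (φ : Matching X g h) {a : H₁} (ha : φ.glue (.inl a) ≠ .inl a) :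
    ∃ b : g.LegIn X, a = b.half ∧ φ.glue (.inl a) = .inr (φ.equiv b).half := by
  by_cases hb : ∃ ha : g.rot a = a, g.colour a ha ∈ X
  · exact ⟨toLeg hb, rfl, φ.glue_inl (toLeg hb)⟩
  · exact absurd (φ.glue_inl_of_not hb) ha

theorem Matching.exists_leg_of_glue_inr_ne {H₁ : Type v} {H₂ : Type w} {g : Diagram Y H₁}
    {h : Diagram Y H₂} (φ : Matching X g h) {a : H₂} (ha : φ.glue (.inr a) ≠ .inr a) :
    ∃ b : g.LegIn X, a = (φ.equiv b).half ∧ φ.glue (.inr a) = .inl b.half := by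
  by_cases hb : ∃ ha : h.rot a = a, h.colour a ha ∈ X
  · refine ⟨φ.equiv.symm (toLeg hb), ?_, φ.glue_inr (toLeg hb)⟩
    rw [Equiv.apply_symm_apply]
    rfl
  · exact absurd (φ.glue_inr_of_not hb) ha

/-- Two steps along a path of struts. -/
theorem exists_strutChain (hB : IsPrimitive B) (hC : IsPrimitive C)
    (hm : MvPowerSeries.coeff m (expSeries B) ≠ 0) (hn : MvPowerSeries.coeff n (expSeries C) ≠ 0)
    (φ : Matching X m.diagram n.diagram) (a : m.diagram.LegIn X)
    (h0 : φ.glue ((m.diagram.sum n.diagram).opp (.inl a.half)) ≠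
      (m.diagram.sum n.diagram).opp (.inl a.half))
    (h1 : φ.glue ((m.diagram.sum n.diagram).opp (φ.isPairing_glue.step (.inl a.half))) ≠
      (m.diagram.sum n.diagram).opp (φ.isPairing_glue.step (.inl a.half))) :
    ∃ c : m.diagram.LegIn X,
      φ.isPairing_glue.step (φ.isPairing_glue.step (.inl a.half)) = .inl c.half ∧
      StrutChain X B C (m.diagram.legColour X a) (m.diagram.legColour X c) := by
  obtain ⟨b, hb, hb'⟩ := φ.exists_leg_of_glue_inl_ne (a := m.diagram.opp a.half) h0
  have hs : φ.isPairing_glue.step (.inl a.half) = .inr (φ.equiv b).half := hb'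
  rw [hs] at h1 ⊢
  obtain ⟨c, hc, hc'⟩ :=
    φ.exists_leg_of_glue_inr_ne (a := n.diagram.opp (φ.equiv b).half) h1
  refine ⟨c, hc', a.2.2, c.2.2, m.diagram.legColour X b, b.2.2, coeff_strut_ne_zero hB hm hb, ?_⟩
  have := coeff_strut_ne_zero hC hn hc
  rwa [φ.legColour_equiv, φ.legColour_equiv] at this

/-- Paths that start at a glued leg are bounded in terms of the number of colours that can be
reached by chains of struts. -/
theorem exists_end_of_leg [Finite Y] (hB : IsPrimitive B) (hC : IsPrimitive C)
    (hBC : NoStrutCircle X B C) (hm : MvPowerSeries.coeff m (expSeries B) ≠ 0)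
    (hn : MvPowerSeries.coeff n (expSeries C) ≠ 0)
    (φ : Matching X m.diagram n.diagram) (N : ℕ) (a : m.diagram.LegIn X)
    (ha : {z | Relation.TransGen (StrutChain X B C) (m.diagram.legColour X a) z}.ncard ≤ N) :
    ∃ j < 2 * N + 2, φ.glue ((m.diagram.sum n.diagram).opp
      ((φ.isPairing_glue.step ^ j) (.inl a.half))) =
      (m.diagram.sum n.diagram).opp ((φ.isPairing_glue.step ^ j) (.inl a.half)) := by
  induction N generalizing a with
  | zero =>
    by_contra! hne
    obtain ⟨c, -, hc⟩ := exists_strutChain hB hC hm hn φ a (hne 0 (by lia)) (hne 1 (by lia))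
    rw [Nat.le_zero, Set.ncard_eq_zero] at ha
    exact Set.eq_empty_iff_forall_notMem.1 ha _ (Relation.TransGen.single hc)
  | succ N ih =>
    by_contra! hne
    obtain ⟨c, hc', hc⟩ := exists_strutChain hB hC hm hn φ a (hne 0 (by lia)) (hne 1 (by lia))
    -- The inclusion is strict: the colour of `c` can be reached from that of `a`, but not from
    -- itself. Each unit of `N` thus pays for two steps, one along a strut of `B` and one along a
    -- strut of `C`.
    have hlt : {z | Relation.TransGen (StrutChain X B C) (m.diagram.legColour X c) z}.ncard <
        {z | Relation.TransGen (StrutChain X B C) (m.diagram.legColour X a) z}.ncard :=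
      Set.ncard_lt_ncard ⟨fun z hz => Relation.TransGen.head hc hz,
        fun h => hBC _ (h (Relation.TransGen.single hc))⟩
    obtain ⟨j, hj, h⟩ := ih c (by lia)
    refine hne (j + 2) (by lia) ?_
    rw [pow_add, Equiv.Perm.mul_apply, pow_two, Equiv.Perm.mul_apply, hc', h]

/-- All paths of edges are bounded in terms of the number of colours. -/
theorem exists_end [Finite Y] (hB : IsPrimitive B) (hC : IsPrimitive C)
    (hBC : NoStrutCircle X B C) (hm : MvPowerSeries.coeff m (expSeries B) ≠ 0)
    (hn : MvPowerSeries.coeff n (expSeries C) ≠ 0)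
    (φ : Matching X m.diagram n.diagram) (s : m.Half ⊕ n.Half) :
    ∃ j < 2 * Nat.card Y + 4, φ.glue ((m.diagram.sum n.diagram).opp
      ((φ.isPairing_glue.step ^ j) s)) =
      (m.diagram.sum n.diagram).opp ((φ.isPairing_glue.step ^ j) s) := by
  have key : ∀ a : m.diagram.LegIn X, ∃ j < 2 * Nat.card Y + 2,
      φ.glue ((m.diagram.sum n.diagram).opp ((φ.isPairing_glue.step ^ j) (.inl a.half))) =
      (m.diagram.sum n.diagram).opp ((φ.isPairing_glue.step ^ j) (.inl a.half)) := fun a =>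
    exists_end_of_leg hB hC hBC hm hn φ _ a (Set.ncard_univ Y ▸
      Set.ncard_le_ncard (Set.subset_univ _))
  by_contra! hne
  -- A path that does not end at once comes to a glued leg of `m` after at most two steps, whence 4
  -- in place of 2 in the bound.
  have h0 := hne 0 (by lia)
  have h1 := hne 1 (by lia)
  rw [pow_zero, Equiv.Perm.one_apply] at h0
  rw [pow_one] at h1
  rcases hs : (m.diagram.sum n.diagram).opp s with a | b
  · rw [hs] at h0
    obtain ⟨a', -, ha'⟩ := φ.exists_leg_of_glue_inl_ne h0
    have hstep : φ.isPairing_glue.step s = .inr (φ.equiv a').half := by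
      rw [IsPairing.step_apply, hs, ha']
    rw [hstep] at h1
    obtain ⟨c, -, hc'⟩ :=
      φ.exists_leg_of_glue_inr_ne (a := n.diagram.opp (φ.equiv a').half) h1
    obtain ⟨j, hj, h⟩ := key c
    refine hne (j + 2) (by lia) ?_
    have hstep' : φ.isPairing_glue.step (.inr (φ.equiv a').half) = .inl c.half := hc'
    rw [pow_add, Equiv.Perm.mul_apply, pow_two, Equiv.Perm.mul_apply, hstep, hstep', h]
  · rw [hs] at h0
    obtain ⟨c, -, hc'⟩ := φ.exists_leg_of_glue_inr_ne h0
    obtain ⟨j, hj, h⟩ := key c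
    refine hne (j + 1) (by lia) ?_
    have hstep : φ.isPairing_glue.step s = .inl c.half := by
      rw [IsPairing.step_apply, hs, hc']
    rw [pow_add, Equiv.Perm.mul_apply, pow_one, hstep, h]

/-- Each half-edge is recorded by the number of steps to the end of its path and by the surviving
half-edge found there. Since `step` and `opp` are bijective, these data determine it. -/
theorem card_half_le [Finite Y] (hB : IsPrimitive B) (hC : IsPrimitive C)
    (hBC : NoStrutCircle X B C) (hm : MvPowerSeries.coeff m (expSeries B) ≠ 0)
    (hn : MvPowerSeries.coeff n (expSeries C) ≠ 0) {k : Graph (Xᶜ : Set Y)}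
    {φ : Matching X m.diagram n.diagram} (hφ : IsGluing φ k.diagram) :
    Nat.card (m.Half ⊕ n.Half) ≤ (2 * Nat.card Y + 4) * Nat.card k.Half := by
  rw [isGluing_iff] at hφ
  obtain ⟨e, he⟩ := hφ
  have hex : ∀ s, ∃ p : Fin (2 * Nat.card Y + 4) × k.Half, e p.2 =
      (m.diagram.sum n.diagram).opp ((φ.isPairing_glue.step ^ (p.1 : ℕ)) s) := fun s => by
    obtain ⟨j, hj, h⟩ := exists_end hB hC hBC hm hn φ s
    obtain ⟨c, hc⟩ := (he.mem_range _).2 ⟨trivial, h⟩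
    exact ⟨(⟨j, hj⟩, c), hc⟩
  choose f hf using hex
  have hinj : Function.Injective f := fun s t h => by
    have h1 := hf s
    rw [h, hf t] at h1
    exact ((φ.isPairing_glue.step ^ _).injective
      ((m.diagram.sum n.diagram).opp_involutive.injective h1)).symm
  have := Nat.card_le_card_of_injective f hinj
  rwa [Nat.card_prod, Nat.card_eq_fintype_card (α := Fin _), Fintype.card_fin] at this

end Bound

theorem exists_isGluing_of_gluingTerm_ne_zero {f g : DSeries Y} {k : Graph (Xᶜ : Set Y)}
    {p : Graph Y × Graph Y} (hp : gluingTerm X f g k p ≠ 0) :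
    ∃ φ : Matching X p.1.diagram p.2.diagram, IsGluing φ k.diagram := by
  have h := Nat.cast_ne_zero.1 (right_ne_zero_of_mul hp)
  by_contra! hne
  have : IsEmpty {φ : Matching X p.1.diagram p.2.diagram // IsGluing φ k.diagram} :=
    ⟨fun φ => hne φ.1 φ.2⟩
  exact h Nat.card_of_isEmpty

theorem gluingDefined_expSeries [Finite Y] {B C : DSeries Y} (hB : IsPrimitive B)
    (hC : IsPrimitive C) (hBC : NoStrutCircle X B C) :
    GluingDefined X (expSeries B) (expSeries C) := by
  intro k
  refine ((finite_graph_card_half_le ((2 * Nat.card Y + 4) * Nat.card k.Half)).prod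
    (finite_graph_card_half_le ((2 * Nat.card Y + 4) * Nat.card k.Half))).subset fun p hp => ?_
  obtain ⟨φ, hφ⟩ := exists_isGluing_of_gluingTerm_ne_zero hp
  have h := left_ne_zero_of_mul hp
  have h1 := card_half_le hB hC hBC (left_ne_zero_of_mul h) (right_ne_zero_of_mul h) hφ
  rw [Nat.card_sum] at h1
  exact ⟨(Nat.le_add_right _ _).trans h1, (Nat.le_add_left _ _).trans h1⟩

/-! ### The constant term, and recognition of an exponential -/

instance isEmpty_half_zero : IsEmpty (Graph.Half (0 : Graph Y)) :=
  ⟨fun a => a.2.1.elim0⟩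

theorem Graph.eq_zero_of_isEmpty {m : Graph Y} (h : IsEmpty m.Half) : m = 0 := by
  ext i
  by_contra hi
  exact h.false ⟨i, ⟨0, Nat.pos_of_ne_zero hi⟩, i.rep_connected.1.some⟩

theorem gluingNumber_zero : gluingNumber X (0 : Graph Y) 0 0 = 1 := by
  have hl : IsEmpty (Diagram.LegIn (Graph.diagram (0 : Graph Y)) X) :=
    ⟨fun a => isEmpty_half_zero.false a.half⟩
  rw [gluingNumber, Nat.card_eq_one_iff_unique]
  refine ⟨⟨fun φ ψ => Subtype.ext (Matching.ext fun a => hl.elim a)⟩,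
    ⟨⟨⟨Equiv.equivOfIsEmpty _ _, fun a => hl.elim a⟩, (isGluing_iff _ _).2 ?_⟩⟩⟩
  exact ⟨isEmptyElim, fun a => isEmptyElim a, fun s => isEmptyElim s, fun a => isEmptyElim a,
    fun a => isEmptyElim a, fun a => isEmptyElim a, fun s => isEmptyElim s⟩

/-- Every path in a gluing has an end that survives, so only empty graphs can be glued to the empty
graph. -/
theorem coeff_zero_gluing {B C : DSeries Y} (hB : IsPrimitive B) (hC : IsPrimitive C) :
    MvPowerSeries.coeff 0 (gluing X (expSeries B) (expSeries C)) = 1 := by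
  have h : MvPowerSeries.coeff 0 (gluing X (expSeries B) (expSeries C)) =
      ∑ᶠ p, gluingTerm X (expSeries B) (expSeries C) 0 p := rfl
  rw [h, finsum_eq_single _ (0, 0)]
  · rw [gluingTerm, coeff_zero_expSeries hB, coeff_zero_expSeries hC, gluingNumber_zero]
    norm_num
  · intro p hp
    by_contra hne
    obtain ⟨φ, hφ⟩ := exists_isGluing_of_gluingTerm_ne_zero hne
    rw [isGluing_iff] at hφ
    obtain ⟨e, he⟩ := hφ
    have h1 : ∀ s, False := fun s => by
      obtain ⟨c, -⟩ := he.cover s trivial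
      exact isEmpty_half_zero.false c
    exact hp (Prod.ext (Graph.eq_zero_of_isEmpty ⟨fun a => h1 (.inl a)⟩)
      (Graph.eq_zero_of_isEmpty ⟨fun a => h1 (.inr a)⟩))

theorem isPrimitive_primitivePart (f : DSeries Y) : IsPrimitive (primitivePart f) := by
  intro m hm
  by_contra h
  exact hm (if_neg h)

theorem coeff_single_primitivePart (f : DSeries Y) (i : Conn Y) :
    MvPowerSeries.coeff (Finsupp.single i 1) (primitivePart f) =
      MvPowerSeries.coeff (Finsupp.single i 1) f :=
  if_pos ⟨i, rfl⟩

/-- A series whose coefficients, multiplied by the symmetry factors, are multiplicative is the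
exponential of its primitive part. -/
theorem eq_expSeries_primitivePart {f : DSeries Y} (h0 : MvPowerSeries.coeff 0 f = 1)
    (hmul : ∀ k l, MvPowerSeries.coeff k f * MvPowerSeries.coeff l f =
      multFact (k + l) / (multFact k * multFact l) * MvPowerSeries.coeff (k + l) f) :
    f = expSeries (primitivePart f) := by
  ext m
  refine mul_left_cancel₀ (multFact_ne_zero m) ?_
  rw [coeff_expSeries (isPrimitive_primitivePart f)]
  induction m using induction_add_single with
  | h0 => rw [h0, multFact_zero, multPow_zero, one_mul]
  | h1 i m ih =>
    -- Multiplicativity is needed only when one of the two graphs is connected; the factorial factor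
    -- of that graph is 1.
    rw [multPow_add, multPow_single, coeff_single_primitivePart, ← ih, mul_assoc, hmul]
    have h1 : multFact (Finsupp.single i 1) = 1 := by
      simpa [multFact_zero] using multFact_add_single 0 i
    have := multFact_ne_zero m
    rw [h1]
    field_simp

end UniTri

theorem theorem2p4 {Y : Type*} [Finite Y] (X : Set Y) (B C : UniTri.DSeries Y)
    (hB : UniTri.IsPrimitive B) (hC : UniTri.IsPrimitive C) (hCs : C ∈ UniTri.DSeriesS Y)
    (hBC : UniTri.NoStrutCircle X B C) :
    UniTri.GluingDefined X (UniTri.expSeries B) (UniTri.expSeries C) ∧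
      UniTri.gluing X (UniTri.expSeries B) (UniTri.expSeries C) =
        UniTri.expSeries (UniTri.primitivePart
          (UniTri.gluing X (UniTri.expSeries B) (UniTri.expSeries C))) := by
  have hdef := UniTri.gluingDefined_expSeries hB hC hBC
  exact ⟨hdef, UniTri.eq_expSeries_primitivePart (UniTri.coeff_zero_gluing hB hC)
    (UniTri.finsum_gluingTerm_mul hB hC hdef)⟩
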